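/- **Setting.** Object variables range over a set of objects; numeric and temporal variables range over the integers. A constraint is a relation on the values of a finite tuple of variables (types and domains are unary constraints). Assertions are persistences $[s,e]\,sv=v$ (with the implicit constraint $s\le e$), changes $[s,e]\,sv:v\mapsto w$ (with $s<e$) and assignments $[t]\,sv:=v$, which are changes over $[t-1,t]$ from an arbitrary value to $v$. A persistence or change *needs* $\langle sv=v\rangle$ at its start; a change (resp. assignment) *produces* $\langle sv=w\rangle$ (resp. $\langle sv=v\rangle$) at its end. An action template consists of typed parameters, start and end timepoints, the task it achieves, a flag "task-dependent" (otherwise it is *free*), and finite sets of timed subtasks, assertions and constraints. An action instance is a copy of a template with fresh variables. A chronicle $\phi=(\pi,\mathcal F,\mathcal C)$ consists of a partial plan $\pi$ (action instances, unrefined tasks, and the record of which action refines which task), a set $\mathcal F$ of assertions and a set $\mathcal C$ of constraints. A planning problem consists of a set of action templates and an initial chronicle $\phi_0$, with finitely many tasks, assertions and constraints and no actions. An *instantiation* of $\phi$ is an assignment of its variables that satisfies $\mathcal C$ and the implicit constraints. *Transformations:* (1) refining an unrefined task $\tau$ by a new action instance $a$ achieving it: $\tau$ is removed, and $a$, its subtasks,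 assertions and constraints are added, together with the constraint $task(a)=\tau$ that unifies parameters, start and end times; (2) inserting a new instance of a free action; (3) adding finitely many persistences and constraints (a *plan restriction*). A chronicle is *reachable* from another one if it results from a finite sequence of transformations. *Conflicts:* a change is viewed as a persistence of $v$ at $s$, the value "undefined" (different from every value, itself included) over the open real interval $]s,e[$, and a persistence of $w$ at $e$; an assignment likewise, without requirement at its start. Two such elementary requirements of two distinct assertions *conflict* in an instantiation if they are on the same state variable, their (real) intervals intersect and their values differ. *Causal support:* $\beta\in\mathcal F$ *supports* $\alpha$ if in every instantiation $\beta$ produces the fluent that $\alpha$ needs, not later than the start of $\alpha$, and at each time from the end of $\beta$ to the start of $\alpha$ some assertion of $\mathcal F$ requires this fluent. Assignments are supported a priori. A *solution plan* is a chronicle that is reachable from $\phi_0$, has no unrefined task, has all its assertions causally supported, and is necessarily consistent: it has an instantiation, and no instantiation has conflicting assertions. *Possible effects:* a fluent is a possible effect of an action instance if one of the action's own assertions produces it, or if it is a possible effect of an action refining one of its subtasks; it is a possible effect of a task if it is one of an action achieving that task. The minimal delay $\Delta(\tau,f)$ is the infimum, over all such chains of (consistent instances of) actions, of the sum of the delays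 along the chain, from the start of $\tau$ to the production of $f$, where the delays of successive levels are considered independently of each other. An action descends from $\tau$ if it refines $\tau$ or refines a subtask of an action descending from $\tau$; a task descends from $\tau$ if it is a subtask of such an action. *Procedure FAPE.* A search state consists of a chronicle, the causal links introduced so far, and for each assertion $\alpha$ a set $DT_\alpha$ of tasks (commitments); initially the chronicle is $\phi_0$ and there are no links and no commitments. The *flaws* are: (a) each unrefined task; (b) each $\alpha\in\mathcal F$ that is not an assignment, not itself a causal link, and has no incoming causal link (unsupported assertion; it cannot be selected while $DT_\alpha$ contains an unrefined task); (c) each pair of elementary requirements of two distinct assertions that conflict in some instantiation. If there is no flaw, the chronicle is returned, provided that it has an instantiation (otherwise it is a dead end). Otherwise an arbitrary flaw selection strategy selects a flaw, a resolver is chosen nondeterministically (failure if there is none), it is applied, and one recurses. The *resolvers* are: - for an unrefined task $\tau$: refinement by a new instance of a template whose task is unifiable with $\tau$ consistently with the chronicle and the template and which, for each unsupported $\alpha$ with $\tau\in DT_\alpha$, has a possible effect that can be the fluent needed by $\alpha$; - for an unsupported $\alpha$ needing $\langle sv=v\rangle$: (direct) a causal link $\beta\to\alpha$, i.e. adding the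 persistence $[end(\beta),start(\alpha)]\,sv=v$, the constraint $end(\beta)\le start(\alpha)$ and equality of the produced and the needed fluent, for a $\beta\in\mathcal F$ that can produce $\langle sv=v\rangle$ and was added by an action descending from every task of $DT_\alpha$; (existing task) adding to $DT_\alpha$ an unrefined task $\tau$ that descends from every task of $DT_\alpha$ and such that, in some instantiation, $\langle sv=v\rangle$ is a possible effect of $\tau$ with $\Delta(\tau,\langle sv=v\rangle)\le start(\alpha)-start(\tau)$; (new action) if $DT_\alpha=\emptyset$, inserting a new instance $a$ of a free template that can have $\langle sv=v\rangle$ as a possible effect, and adding $task(a)$ (the root of a new refinement tree) to $DT_\alpha$; - for a conflict: posting one constraint among: a disequality $x_i\ne y_i$ of corresponding arguments of the two state variables; the end of one interval is before the start of the other (strictly if both intervals are closed, weakly otherwise); equality of the two values (if neither is undefined). **Proposition.** For every planning problem, FAPE is sound and complete: 1. *(Soundness)* For every flaw selection strategy, every chronicle returned by FAPE is a solution plan. 2. *(Completeness)* For every flaw selection strategy, if a solution plan exists, then FAPE can return a chronicle. More precisely, for each solution plan $\psi$ and each instantiation $\sigma$ of $\psi$, FAPE can return a chronicle $\phi$ from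 which one can reach a solution plan $\psi'$ that is a plan restriction of $\psi$ and still has the instantiation $\sigma$. 3. *(The resolvers cover every solution plan)* A *completion* of a search state is a solution plan that is reachable from its chronicle and in which each $\alpha$ with $DT_\alpha\neq\emptyset$ has a causal supporter added by an action descending from every task of $DT_\alpha$. Every solution plan is a completion of the initial state. For each state of the search space, each selectable flaw of any of the three types, each completion $\psi$ of the state and each instantiation $\sigma$ of $\psi$, there are a resolver of the flaw and a solution plan $\psi'$ that is a plan restriction of $\psi$, still has the instantiation $\sigma$, and is a completion of the state obtained by applying the resolver. -/

import Mathlib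

namespace FAPE

/-! ## Variables, terms, instantiations -/

/-- A variable named `n`: an object variable, a numeric variable or a temporal variable. -/
inductive Var (N : Type*) where
  | obj (n : N)
  | num (n : N)
  | time (n : N)

/-- The name of a variable. -/
def Var.name {N : Type*} : Var N → N
  | .obj n => n
  | .num n => n
  | .time n => n

/-- Renaming of variables. -/
def Var.map {N M : Type*} (f : N → M) : Var N → Var M
  | .obj n => .obj (f n)
  | .num n => .num (f n)
  | .time n => .time (f n)

/-- An assignment of values to all variables: objects to object variables, integers to numeric and
to temporal variables. -/
structure Assignment (N O : Type*) where
  obj : N → O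
  num : N → ℤ
  time : N → ℤ

/-- The value of a variable. -/
def Assignment.val {N O : Type*} (σ : Assignment N O) : Var N → O ⊕ ℤ
  | .obj n => .inl (σ.obj n)
  | .num n => .inr (σ.num n)
  | .time n => .inr (σ.time n)

/-- Reading an assignment through a renaming. -/
def Assignment.comap {N M O : Type*} (f : N → M) (σ : Assignment M O) : Assignment N O where
  obj n := σ.obj (f n)
  num n := σ.num (f n)
  time n := σ.time (f n)

/-- An object term: a domain constant or an object variable. -/
inductive ObjTerm (N O : Type*) where
  | const (o : O)
  | var (n : N)

def ObjTerm.eval {N O : Type*} (σ : Assignment N O) : ObjTerm N O → O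
  | .const o => o
  | .var n => σ.obj n

def ObjTerm.map {N M O : Type*} (f : N → M) : ObjTerm N O → ObjTerm M O
  | .const o => .const o
  | .var n => .var (f n)

def ObjTerm.names {N O : Type*} : ObjTerm N O → Set N
  | .const _ => ∅
  | .var n => {n}

/-- A timepoint `t + d`, with `t` a temporal variable and `d` an integer constant. -/
structure TimeTerm (N : Type*) where
  var : N
  offset : ℤ

def TimeTerm.eval {N O : Type*} (σ : Assignment N O) (t : TimeTerm N) : ℤ :=
  σ.time t.var + t.offset

def TimeTerm.map {N M : Type*} (f : N → M) (t : TimeTerm N) : TimeTerm M :=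
  ⟨f t.var, t.offset⟩

/-! ## Constraints -/

/-- A constraint: a tuple of variables together with a relation on their values, or one of the
special forms: equality of two tuples of object terms, disequality of two object terms, and
comparison of two timepoints.  Types and domains of variables are unary relations. -/
inductive Constraint (N O : Type*) where
  | rel (xs : List (Var N)) (γ : Set (List (O ⊕ ℤ)))
  | objEq (xs ys : List (ObjTerm N O))
  | objNe (x y : ObjTerm N O)
  | timeEq (s t : TimeTerm N)
  | timeLe (s t : TimeTerm N)
  | timeLt (s t : TimeTerm N)

/-- The assignment satisfies the constraint. -/
def Constraint.Sat {N O : Type*} (σ : Assignment N O) : Constraint N O → Prop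
  | .rel xs γ => xs.map σ.val ∈ γ
  | .objEq xs ys => xs.map (ObjTerm.eval σ) = ys.map (ObjTerm.eval σ)
  | .objNe x y => x.eval σ ≠ y.eval σ
  | .timeEq s t => s.eval σ = t.eval σ
  | .timeLe s t => s.eval σ ≤ t.eval σ
  | .timeLt s t => s.eval σ < t.eval σ

def Constraint.map {N M O : Type*} (f : N → M) : Constraint N O → Constraint M O
  | .rel xs γ => .rel (xs.map (Var.map f)) γ
  | .objEq xs ys => .objEq (xs.map (ObjTerm.map f)) (ys.map (ObjTerm.map f))
  | .objNe x y => .objNe (x.map f) (y.map f)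
  | .timeEq s t => .timeEq (s.map f) (t.map f)
  | .timeLe s t => .timeLe (s.map f) (t.map f)
  | .timeLt s t => .timeLt (s.map f) (t.map f)

def Constraint.names {N O : Type*} : Constraint N O → Set N
  | .rel xs _ => {n | ∃ x ∈ xs, x.name = n}
  | .objEq xs ys => {n | ∃ x ∈ xs ++ ys, n ∈ x.names}
  | .objNe x y => x.names ∪ y.names
  | .timeEq s t => {s.var, t.var}
  | .timeLe s t => {s.var, t.var}
  | .timeLt s t => {s.var, t.var}

/-! ## State variables, fluents, assertions -/

/-- A state variable `sv(x₁, …, xₙ)` with object terms as arguments. -/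
structure StateVar (N O SV : Type*) where
  sym : SV
  args : List (ObjTerm N O)

/-- A ground fluent: a ground state variable and its value. -/
abbrev Fluent (O SV : Type*) := (SV × List O) × O

def StateVar.eval {N O SV : Type*} (σ : Assignment N O) (x : StateVar N O SV) : SV × List O :=
  (x.sym, x.args.map (ObjTerm.eval σ))

def StateVar.map {N M O SV : Type*} (f : N → M) (x : StateVar N O SV) : StateVar M O SV :=
  ⟨x.sym, x.args.map (ObjTerm.map f)⟩

def StateVar.names {N O SV : Type*} (x : StateVar N O SV) : Set N :=
  {n | ∃ y ∈ x.args, n ∈ y.names}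

/-- A temporally qualified assertion: a persistence `[s, e] sv = v`, a change
`[s, e] sv : v ↦ w`, or an assignment `[t] sv := v`. -/
inductive Assertion (N O SV : Type*) where
  | persistence (s e : TimeTerm N) (sv : StateVar N O SV) (v : ObjTerm N O)
  | change (s e : TimeTerm N) (sv : StateVar N O SV) (v w : ObjTerm N O)
  | assign (t : TimeTerm N) (sv : StateVar N O SV) (v : ObjTerm N O)

namespace Assertion

variable {N M O SV : Type*}

/-- The start of an assertion; the assignment `[t] sv := v` is a change over `[t - 1, t]`. -/
def start : Assertion N O SV → TimeTerm N
  | .persistence s _ _ _ => s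
  | .change s _ _ _ _ => s
  | .assign t _ _ => ⟨t.var, t.offset - 1⟩

/-- The end of an assertion. -/
def finish : Assertion N O SV → TimeTerm N
  | .persistence _ e _ _ => e
  | .change _ e _ _ _ => e
  | .assign t _ _ => t

def stateVar : Assertion N O SV → StateVar N O SV
  | .persistence _ _ sv _ => sv
  | .change _ _ sv _ _ => sv
  | .assign _ sv _ => sv

/-- The value that the assertion needs at its start (none for an assignment). -/
def needs : Assertion N O SV → Option (ObjTerm N O)
  | .persistence _ _ _ v => some v
  | .change _ _ _ v _ => some v
  | .assign _ _ _ => none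

/-- The value that the assertion produces at its end (none for a persistence). -/
def produces : Assertion N O SV → Option (ObjTerm N O)
  | .persistence _ _ _ _ => none
  | .change _ _ _ _ w => some w
  | .assign _ _ v => some v

def IsPersistence : Assertion N O SV → Prop
  | .persistence _ _ _ _ => True
  | _ => False

def IsAssignment : Assertion N O SV → Prop
  | .assign _ _ _ => True
  | _ => False

/-- `f` is the fluent `⟨sv = v⟩` needed by the assertion at its start. -/
def Needs (σ : Assignment N O) (α : Assertion N O SV) (f : Fluent O SV) : Prop :=
  ∃ v, α.needs = some v ∧ f = (α.stateVar.eval σ, v.eval σ)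

/-- `f` is the fluent `⟨sv = v⟩` produced by the assertion at its end. -/
def Produces (σ : Assignment N O) (α : Assertion N O SV) (f : Fluent O SV) : Prop :=
  ∃ v, α.produces = some v ∧ f = (α.stateVar.eval σ, v.eval σ)

/-- The temporal constraint implicit in an assertion: a persistence spans a nonempty interval
`[s, e]`, a change starts strictly before it ends. -/
def WellTimed (σ : Assignment N O) : Assertion N O SV → Prop
  | .persistence s e _ _ => s.eval σ ≤ e.eval σ
  | .change s e _ _ _ => s.eval σ < e.eval σ
  | .assign _ _ _ => True

def map (f : N → M) : Assertion N O SV → Assertion M O SV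
  | .persistence s e sv v => .persistence (s.map f) (e.map f) (sv.map f) (v.map f)
  | .change s e sv v w => .change (s.map f) (e.map f) (sv.map f) (v.map f) (w.map f)
  | .assign t sv v => .assign (t.map f) (sv.map f) (v.map f)

def names : Assertion N O SV → Set N
  | .persistence s e sv v => {s.var, e.var} ∪ sv.names ∪ v.names
  | .change s e sv v w => {s.var, e.var} ∪ sv.names ∪ v.names ∪ w.names
  | .assign t sv v => {t.var} ∪ sv.names ∪ v.names

end Assertion

/-! ## Conflicts -/

/-- An elementary requirement on a state variable over an interval, closed or open at both ends.
The value `none` is the special value `undefined`, different from every value and from itself. -/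
structure Requirement (N O SV : Type*) where
  stateVar : StateVar N O SV
  lo : TimeTerm N
  hi : TimeTerm N
  isOpen : Prop
  value : Option (ObjTerm N O)

/-- The interval of the time line over which the requirement holds. -/
def Requirement.extent {N O SV : Type*} (σ : Assignment N O) (p : Requirement N O SV) : Set ℝ :=
  {r | (p.isOpen ∧ (p.lo.eval σ : ℝ) < r ∧ r < (p.hi.eval σ : ℝ)) ∨
       (¬ p.isOpen ∧ (p.lo.eval σ : ℝ) ≤ r ∧ r ≤ (p.hi.eval σ : ℝ))}

/-- Two requirements conflict: same state variable, overlapping intervals, different values. -/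
def Requirement.Conflict {N O SV : Type*} (σ : Assignment N O) (p q : Requirement N O SV) : Prop :=
  p.stateVar.eval σ = q.stateVar.eval σ ∧
  (p.extent σ ∩ q.extent σ).Nonempty ∧
  ¬ ∃ v w, p.value = some v ∧ q.value = some w ∧ v.eval σ = w.eval σ

/-- The requirements an assertion is made of.  A change is a start persistence, an intermediate
`undefined` over the open interval, and an end persistence.  An assignment `[t] sv := v` is the
change `[t - 1, t] sv : any ↦ v`; since `any` can take any value, its start requires nothing. -/
def Assertion.requirements {N O SV : Type*} : Assertion N O SV → List (Requirement N O SV)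
  | .persistence s e sv v => [⟨sv, s, e, False, some v⟩]
  | .change s e sv v w =>
      [⟨sv, s, s, False, some v⟩, ⟨sv, s, e, True, none⟩, ⟨sv, e, e, False, some w⟩]
  | .assign t sv v =>
      [⟨sv, ⟨t.var, t.offset - 1⟩, t, True, none⟩, ⟨sv, t, t, False, some v⟩]

/-- The constraints that can be posted to resolve a conflict between two requirements: separation
of one pair of arguments of the state variables, temporal separation (strict between two closed
intervals), or unification of the two values when none of them is `undefined`. -/
def Requirement.separations {N O SV : Type*} (p q : Requirement N O SV) :
    Set (Constraint N O) :=
  {c | ∃ xy ∈ p.stateVar.args.zip q.stateVar.args, c = .objNe xy.1 xy.2} ∪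
  {c | ¬ p.isOpen ∧ ¬ q.isOpen ∧ (c = .timeLt p.hi q.lo ∨ c = .timeLt q.hi p.lo)} ∪
  {c | (p.isOpen ∨ q.isOpen) ∧ (c = .timeLe p.hi q.lo ∨ c = .timeLe q.hi p.lo)} ∪
  {c | ∃ v w, p.value = some v ∧ q.value = some w ∧ c = .objEq [v] [w]}

/-! ## Tasks, action templates, planning problems -/

/-- A temporally qualified task `[s, e] tsk(x₁, …, xₙ)`. -/
structure Task (N O T : Type*) where
  sym : T
  args : List (ObjTerm N O)
  start : TimeTerm N
  finish : TimeTerm N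

def Task.map {N M O T : Type*} (f : N → M) (τ : Task N O T) : Task M O T :=
  ⟨τ.sym, τ.args.map (ObjTerm.map f), τ.start.map f, τ.finish.map f⟩

def Task.names {N O T : Type*} (τ : Task N O T) : Set N :=
  {τ.start.var, τ.finish.var} ∪ {n | ∃ y ∈ τ.args, n ∈ y.names}

/-- An action template.  Its variables are named by natural numbers that are local to it; `start`
and `finish` are the temporal variables of its start and end.  A parameter is an object variable
with its type, a set of objects. -/
structure Template (O SV T : Type*) where
  name : String
  params : List (ℕ × Set O)
  start : ℕ
  finish : ℕ
  taskSym : T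
  taskArgs : List (ObjTerm ℕ O)
  dependent : Prop
  subtasks : Finset (Task ℕ O T)
  assertions : Finset (Assertion ℕ O SV)
  constraints : Finset (Constraint ℕ O)

/-- The task achieved by a template, qualified by its start and end. -/
def Template.task {O SV T : Type*} (A : Template O SV T) : Task ℕ O T :=
  ⟨A.taskSym, A.taskArgs, ⟨A.start, 0⟩, ⟨A.finish, 0⟩⟩

/-- The constraints of a template, including the types of its parameters. -/
def Template.allConstraints {O SV T : Type*} (A : Template O SV T) : Set (Constraint ℕ O) :=
  ↑A.constraints ∪
    {c | ∃ p ∈ A.params, c = .rel [.obj p.1] {l | ∃ o ∈ p.2, l = [.inl o]}}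

/-- `θ` instantiates the variables of the template consistently with its constraints. -/
def Template.IsInstance {O SV T : Type*} (A : Template O SV T) (θ : Assignment ℕ O) : Prop :=
  (∀ c ∈ A.allConstraints, c.Sat θ) ∧ ∀ α ∈ A.assertions, α.WellTimed θ

/-- A planning problem: the action templates of the domain (over the objects `O`, the state
variable symbols `SV` and the task symbols `T`), and the tasks, assertions and constraints of the
initial chronicle, whose variables are named by natural numbers. -/
structure Problem (O SV T : Type*) where
  actions : Set (Template O SV T)
  tasks : Finset (Task ℕ O T)
  assertions : Finset (Assertion ℕ O SV)
  constraints : Finset (Constraint ℕ O)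

/-! ## Chronicles -/

/-- Names of variables in a chronicle: `(none, n)` is the variable `n` of the problem,
`(some k, n)` is the variable `n` of the action instance with identifier `k`. -/
abbrev Name := Option ℕ × ℕ

/-- An action instance: a template whose variables are renamed by means of an identifier. -/
structure Action (O SV T : Type*) where
  id : ℕ
  template : Template O SV T

/-- Where a task of a plan comes from: the initial chronicle, the subtasks of the action instance
`k`, or the task achieved by an action instance `k` that was inserted freely. -/
inductive Origin where
  | initial
  | sub (k : ℕ)
  | root (k : ℕ)

/-- An occurrence of a task in a plan. -/
structure PlanTask (O T : Type*) where
  origin : Origin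
  task : Task Name O T

namespace Action

variable {O SV T : Type*}

/-- The renaming of the variables of the template. -/
def rename (a : Action O SV T) : ℕ → Name := fun n => (some a.id, n)

def task (a : Action O SV T) : Task Name O T := a.template.task.map a.rename

def rootTask (a : Action O SV T) : PlanTask O T := ⟨.root a.id, a.task⟩

def subtasks (a : Action O SV T) : Set (PlanTask O T) :=
  {τ | ∃ t ∈ a.template.subtasks, τ = ⟨.sub a.id, t.map a.rename⟩}

def assertions (a : Action O SV T) : Set (Assertion Name O SV) :=
  {α | ∃ β ∈ a.template.assertions, α = β.map a.rename}

def constraints (a : Action O SV T) : Set (Constraint Name O) :=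
  {c | ∃ c' ∈ a.template.allConstraints, c = c'.map a.rename}

/-- The constraints `task(a) = τ`: the parameters are unified, and the action starts and ends at
the times specified by the task. -/
def unifyTask (a : Action O SV T) (τ : PlanTask O T) : Set (Constraint Name O) :=
  {.objEq a.task.args τ.task.args, .timeEq a.task.start τ.task.start,
    .timeEq a.task.finish τ.task.finish}

end Action

/-- A chronicle `(π, 𝓕, 𝓒)`.  The partial plan `π` consists of the action instances, of the
unrefined tasks, and of a record of which action refines which task. -/
structure Chronicle (O SV T : Type*) where
  actions : Set (Action O SV T)
  tasks : Set (PlanTask O T)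
  refinements : Set (PlanTask O T × Action O SV T)
  assertions : Set (Assertion Name O SV)
  constraints : Set (Constraint Name O)

namespace Chronicle

variable {O SV T : Type*}

/-- The initial chronicle of a problem. -/
def initial (P : Problem O SV T) : Chronicle O SV T where
  actions := ∅
  tasks := {τ | ∃ t ∈ P.tasks, τ = ⟨.initial, t.map (fun n => (none, n))⟩}
  refinements := ∅
  assertions := {α | ∃ β ∈ P.assertions, α = β.map (fun n => (none, n))}
  constraints := {c | ∃ c' ∈ P.constraints, c = c'.map (fun n => (none, n))}

/-- The (consistent) instantiations of a chronicle. -/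
def instances (φ : Chronicle O SV T) : Set (Assignment Name O) :=
  {σ | (∀ c ∈ φ.constraints, c.Sat σ) ∧ ∀ α ∈ φ.assertions, α.WellTimed σ}

/-- No two distinct assertions conflict under the assignment `σ`. -/
def ConflictFree (φ : Chronicle O SV T) (σ : Assignment Name O) : Prop :=
  ∀ α ∈ φ.assertions, ∀ β ∈ φ.assertions, α ≠ β →
    ∀ p ∈ α.requirements, ∀ q ∈ β.requirements, ¬ p.Conflict σ q

/-- Necessary consistency: the constraints are consistent, and no instantiation has conflicting
assertions. -/
def NecessarilyConsistent (φ : Chronicle O SV T) : Prop :=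
  φ.instances.Nonempty ∧ ∀ σ ∈ φ.instances, φ.ConflictFree σ

/-- The fluent `f` holds at time `r`: some assertion requires it. -/
def Holds (φ : Chronicle O SV T) (σ : Assignment Name O) (f : Fluent O SV) (r : ℝ) : Prop :=
  ∃ γ ∈ φ.assertions, ∃ p ∈ γ.requirements, r ∈ p.extent σ ∧
    ∃ v, p.value = some v ∧ f = (p.stateVar.eval σ, v.eval σ)

/-- `β` is a causal supporter of `α`: in all instantiations it produces the fluent needed by `α`,
not later than the start of `α`, and the fluent holds from the end of `β` to the start of `α`. -/
def Supports (φ : Chronicle O SV T) (β α : Assertion Name O SV) : Prop :=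
  β ∈ φ.assertions ∧ ∀ σ ∈ φ.instances, ∃ f, α.Needs σ f ∧ β.Produces σ f ∧
    β.finish.eval σ ≤ α.start.eval σ ∧
    ∀ r : ℝ, (β.finish.eval σ : ℝ) ≤ r → r ≤ (α.start.eval σ : ℝ) → φ.Holds σ f r

/-- Causal support; assignments are a priori supported. -/
def CausallySupported (φ : Chronicle O SV T) (α : Assertion Name O SV) : Prop :=
  α.IsAssignment ∨ ∃ β, φ.Supports β α

/-- The identifier `k` and the variables it owns do not occur in the chronicle. -/
def Fresh (φ : Chronicle O SV T) (k : ℕ) : Prop :=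
  (∀ a ∈ φ.actions, a.id ≠ k) ∧
  (∀ τ ∈ φ.tasks, ∀ n ∈ τ.task.names, n.1 ≠ some k) ∧
  (∀ α ∈ φ.assertions, ∀ n ∈ α.names, n.1 ≠ some k) ∧
  (∀ c ∈ φ.constraints, ∀ n ∈ c.names, n.1 ≠ some k)

/-! ### Transformations -/

/-- Refinement of the task `τ` by the action instance `a`. -/
def refine (φ : Chronicle O SV T) (τ : PlanTask O T) (a : Action O SV T) : Chronicle O SV T where
  actions := φ.actions ∪ {a}
  tasks := (φ.tasks \ {τ}) ∪ a.subtasks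
  refinements := φ.refinements ∪ {(τ, a)}
  assertions := φ.assertions ∪ a.assertions
  constraints := φ.constraints ∪ a.constraints ∪ a.unifyTask τ

/-- Insertion of the action instance `a`, as the root of a new refinement tree. -/
def insert (φ : Chronicle O SV T) (a : Action O SV T) : Chronicle O SV T where
  actions := φ.actions ∪ {a}
  tasks := φ.tasks ∪ a.subtasks
  refinements := φ.refinements ∪ {(a.rootTask, a)}
  assertions := φ.assertions ∪ a.assertions
  constraints := φ.constraints ∪ a.constraints

/-- Insertion of the restrictions `(F, C)`. -/
def restrict (φ : Chronicle O SV T) (F : Set (Assertion Name O SV)) (C : Set (Constraint Name O)) :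
    Chronicle O SV T where
  actions := φ.actions
  tasks := φ.tasks
  refinements := φ.refinements
  assertions := φ.assertions ∪ F
  constraints := φ.constraints ∪ C

/-- `φ'` results from `φ` by a plan restriction: the insertion of finitely many persistence
assertions and constraints. -/
def IsRestriction (φ φ' : Chronicle O SV T) : Prop :=
  ∃ F C, F.Finite ∧ C.Finite ∧ (∀ α ∈ F, α.IsPersistence) ∧ φ' = φ.restrict F C

end Chronicle

/-- The three plan transformations: task refinement, insertion of a free action, plan
restriction. -/
inductive Transformation {O SV T : Type*} (P : Problem O SV T) :
    Chronicle O SV T → Chronicle O SV T → Prop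
  | refine (φ : Chronicle O SV T) (τ : PlanTask O T) (a : Action O SV T)
      (hτ : τ ∈ φ.tasks) (ha : a.template ∈ P.actions) (hk : φ.Fresh a.id)
      (hsym : a.task.sym = τ.task.sym) : Transformation P φ (φ.refine τ a)
  | insert (φ : Chronicle O SV T) (a : Action O SV T)
      (ha : a.template ∈ P.actions) (hk : φ.Fresh a.id)
      (hfree : ¬ a.template.dependent) : Transformation P φ (φ.insert a)
  | restrict (φ φ' : Chronicle O SV T) (h : φ.IsRestriction φ') : Transformation P φ φ'

/-- `φ'` is reachable from `φ` by a finite sequence of transformations. -/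
def Reachable {O SV T : Type*} (P : Problem O SV T) : Chronicle O SV T → Chronicle O SV T → Prop :=
  Relation.ReflTransGen (Transformation P)

/-- Solution plans of a planning problem. -/
def IsSolution {O SV T : Type*} (P : Problem O SV T) (φ : Chronicle O SV T) : Prop :=
  Reachable P (Chronicle.initial P) φ ∧
  φ.tasks = ∅ ∧
  (∀ α ∈ φ.assertions, φ.CausallySupported α) ∧
  φ.NecessarilyConsistent

/-! ## Refinement trees and possible effects -/

/-- `a` is a descendant of the task `τ`: it refines `τ`, or it refines a subtask of an action
descending from `τ`. -/
inductive Chronicle.Descends {O SV T : Type*} (φ : Chronicle O SV T) (τ : PlanTask O T) :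
    Action O SV T → Prop
  | base (a : Action O SV T) (h : (τ, a) ∈ φ.refinements) : Descends φ τ a
  | step (b a : Action O SV T) (τ' : PlanTask O T) (hb : Descends φ τ b)
      (hτ' : τ' ∈ b.subtasks) (h : (τ', a) ∈ φ.refinements) : Descends φ τ a

/-- The task `τ'` is a descendant of the task `τ`: it is a subtask of an action descending from
`τ`. -/
def Chronicle.TaskDescends {O SV T : Type*} (φ : Chronicle O SV T) (τ τ' : PlanTask O T) : Prop :=
  ∃ b, φ.Descends τ b ∧ τ' ∈ b.subtasks

/-- `β` was added by an action descending from `τ`. -/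
def Chronicle.AddedUnder {O SV T : Type*} (φ : Chronicle O SV T) (τ : PlanTask O T)
    (β : Assertion Name O SV) : Prop :=
  ∃ b ∈ φ.actions, β ∈ b.assertions ∧ φ.Descends τ b

/-- The fluent `f` can be produced in the refinement tree of an instance `θ` of the template `A`,
with a delay `d` from the start of the action: either by a direct effect of the action, or by an
instance of a template refining one of its subtasks.  The delays of the successive levels are
considered independently of each other. -/
inductive PossibleEffect {O SV T : Type*} (P : Problem O SV T) (f : Fluent O SV) :
    Template O SV T → Assignment ℕ O → ℤ → Prop
  | direct (A : Template O SV T) (θ : Assignment ℕ O) (β : Assertion ℕ O SV)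
      (hθ : A.IsInstance θ) (hβ : β ∈ A.assertions) (hf : β.Produces θ f) :
      PossibleEffect P f A θ (β.finish.eval θ - θ.time A.start)
  | sub (A B : Template O SV T) (θ θ' : Assignment ℕ O) (t : Task ℕ O T) (d : ℤ)
      (hθ : A.IsInstance θ) (ht : t ∈ A.subtasks) (hB : B ∈ P.actions)
      (hsym : B.taskSym = t.sym)
      (hargs : B.taskArgs.map (ObjTerm.eval θ') = t.args.map (ObjTerm.eval θ))
      (h : PossibleEffect P f B θ' d) :
      PossibleEffect P f A θ ((t.start.eval θ - θ.time A.start) + d)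

/-- The delays with which the fluent `f` can be produced by a refinement of the ground task
`tsk(args)`, counted from the start of the task. -/
def taskDelays {O SV T : Type*} (P : Problem O SV T) (tsk : T) (args : List O)
    (f : Fluent O SV) : Set ℤ :=
  {d | ∃ B ∈ P.actions, ∃ θ : Assignment ℕ O, B.taskSym = tsk ∧
    B.taskArgs.map (ObjTerm.eval θ) = args ∧ PossibleEffect P f B θ d}

/-- The possible effects of a ground task. -/
def taskEffects {O SV T : Type*} (P : Problem O SV T) (tsk : T) (args : List O) :
    Set (Fluent O SV) :=
  {f | (taskDelays P tsk args f).Nonempty}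

/-- The minimal delay from the start of a ground task to the production of a possible effect. -/
noncomputable def minDelay {O SV T : Type*} (P : Problem O SV T) (tsk : T) (args : List O)
    (f : Fluent O SV) : EReal :=
  ⨅ d ∈ taskDelays P tsk args f, ((d : ℝ) : EReal)

/-! ## The planning procedure -/

/-- The causal link `β → α`: the persistence `[end(β), start(α)] sv = v`, where `⟨sv = v⟩` is the
fluent needed by `α`. -/
def causalLink {O SV : Type*} (β α : Assertion Name O SV) : Set (Assertion Name O SV) :=
  {γ | ∃ v, α.needs = some v ∧ γ = .persistence β.finish α.start α.stateVar v}

/-- The constraints that come with the causal link `β → α`: `β` ends before `α` starts, and what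
`β` produces is what `α` needs. -/
def linkConstraints {O SV : Type*} (β α : Assertion Name O SV) : Set (Constraint Name O) :=
  {.timeLe β.finish α.start, .objEq β.stateVar.args α.stateVar.args} ∪
  {c | ∃ v w, α.needs = some v ∧ β.produces = some w ∧ c = .objEq [w] [v]}

/-- A search state: a chronicle, the causal links `(β, α)` introduced so far, and the supporting
tasks commitments `DT_α`. -/
structure SearchState (O SV T : Type*) where
  chronicle : Chronicle O SV T
  links : Set (Assertion Name O SV × Assertion Name O SV)
  commitments : Assertion Name O SV → Set (PlanTask O T)

/-- The search starts from the initial chronicle, without causal links or commitments. -/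
def SearchState.initial {O SV T : Type*} (P : Problem O SV T) : SearchState O SV T where
  chronicle := Chronicle.initial P
  links := ∅
  commitments := fun _ => ∅

/-- Flaws: an unrefined task, an unsupported assertion, or a pair of conflicting assertions,
identified by the two requirements that conflict. -/
inductive Flaw (O SV T : Type*) where
  | unrefined (τ : PlanTask O T)
  | unsupported (α : Assertion Name O SV)
  | conflict (α β : Assertion Name O SV) (p q : Requirement Name O SV)

/-- `α` has no incoming causal link, and is not a priori supported (as assignments and causal links
are). -/
def SearchState.Unsupported {O SV T : Type*} (s : SearchState O SV T)
    (α : Assertion Name O SV) : Prop :=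
  α ∈ s.chronicle.assertions ∧ ¬ α.IsAssignment ∧
  (∀ l ∈ s.links, α ∉ causalLink l.1 l.2) ∧ ∀ β, (β, α) ∉ s.links

/-- The flaws of a search state. -/
def SearchState.IsFlaw {O SV T : Type*} (s : SearchState O SV T) : Flaw O SV T → Prop
  | .unrefined τ => τ ∈ s.chronicle.tasks
  | .unsupported α => s.Unsupported α
  | .conflict α β p q =>
      α ∈ s.chronicle.assertions ∧ β ∈ s.chronicle.assertions ∧ α ≠ β ∧
      p ∈ α.requirements ∧ q ∈ β.requirements ∧ ∃ σ ∈ s.chronicle.instances, p.Conflict σ q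

/-- The flaws that can be selected: the resolution of an unsupported assertion `α` is postponed
while there is an unrefined task in `DT_α`. -/
def SearchState.Selectable {O SV T : Type*} (s : SearchState O SV T) (x : Flaw O SV T) : Prop :=
  s.IsFlaw x ∧ ∀ α, x = .unsupported α → ∀ τ ∈ s.commitments α, τ ∉ s.chronicle.tasks

/-- Resolvers: refine a task by an action instance; add a causal link `β → α`; commit `α` to be
supported from an existing task `τ`; commit `α` to be supported from a newly inserted action;
post a separation or unification constraint. -/
inductive Resolver (O SV T : Type*) where
  | refine (τ : PlanTask O T) (a : Action O SV T)
  | link (β α : Assertion Name O SV)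
  | supportFromTask (α : Assertion Name O SV) (τ : PlanTask O T)
  | supportFromAction (α : Assertion Name O SV) (a : Action O SV T)
  | post (c : Constraint Name O)

/-- The resolvers of a flaw in a search state. -/
def SearchState.IsResolver {O SV T : Type*} (P : Problem O SV T) (s : SearchState O SV T) :
    Flaw O SV T → Resolver O SV T → Prop
  -- Refinement by an instance of a template whose task is unifiable with the unrefined task, and
  -- which has a possible effect for every unsupported assertion committed to that task.
  | .unrefined τ, .refine τ' a =>
      τ' = τ ∧ a.template ∈ P.actions ∧ s.chronicle.Fresh a.id ∧ a.task.sym = τ.task.sym ∧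
      (∃ σ ∈ s.chronicle.instances, a.template.IsInstance (σ.comap a.rename) ∧
        ∀ c ∈ a.unifyTask τ, c.Sat σ) ∧
      ∀ α, s.Unsupported α → τ ∈ s.commitments α →
        ∃ σ ∈ s.chronicle.instances, (∀ c ∈ a.unifyTask τ, c.Sat σ) ∧
          ∃ f d, α.Needs σ f ∧ PossibleEffect P f a.template (σ.comap a.rename) d
  -- Direct supporter: an assertion of the chronicle that can produce the needed fluent, and that
  -- originates from all the tasks in `DT_α`.
  | .unsupported α, .link β α' =>
      α' = α ∧ β ∈ s.chronicle.assertions ∧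
      (∃ σ ∈ s.chronicle.instances, ∃ f, α.Needs σ f ∧ β.Produces σ f) ∧
      ∀ τ ∈ s.commitments α, s.chronicle.AddedUnder τ β
  -- Delayed support from an existing unrefined task that has the needed fluent as a possible
  -- effect, early enough, and that descends from all the tasks in `DT_α`.
  | .unsupported α, .supportFromTask α' τ =>
      α' = α ∧ τ ∈ s.chronicle.tasks ∧
      (∃ σ ∈ s.chronicle.instances, ∃ f, α.Needs σ f ∧
        f ∈ taskEffects P τ.task.sym (τ.task.args.map (ObjTerm.eval σ)) ∧
        minDelay P τ.task.sym (τ.task.args.map (ObjTerm.eval σ)) f ≤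
          (((α.start.eval σ - τ.task.start.eval σ : ℤ) : ℝ) : EReal)) ∧
      ∀ τ' ∈ s.commitments α, s.chronicle.TaskDescends τ' τ
  -- Delayed support from an instance of a free action template that has the needed fluent as a
  -- possible effect, when no commitment was made.
  | .unsupported α, .supportFromAction α' a =>
      α' = α ∧ s.commitments α = ∅ ∧ a.template ∈ P.actions ∧ ¬ a.template.dependent ∧
      s.chronicle.Fresh a.id ∧
      ∃ σ ∈ s.chronicle.instances, ∃ f, α.Needs σ f ∧
        ∃ θ d, PossibleEffect P f a.template θ d
  -- Conflicts are resolved by posting one separation or unification constraint.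
  | .conflict _ _ p q, .post c => c ∈ p.separations q
  | _, _ => False

/-- The search state `s` with `τ` added to the commitments of `α`. -/
def SearchState.commit {O SV T : Type*} (s : SearchState O SV T) (α : Assertion Name O SV)
    (τ : PlanTask O T) : Assertion Name O SV → Set (PlanTask O T) :=
  fun α' => s.commitments α' ∪ {τ' | α' = α ∧ τ' = τ}

/-- The transformation of a search state by a resolver. -/
def SearchState.transform {O SV T : Type*} (s : SearchState O SV T) :
    Resolver O SV T → SearchState O SV T
  | .refine τ a => { s with chronicle := s.chronicle.refine τ a }
  | .link β α =>
      { s with chronicle := s.chronicle.restrict (causalLink β α) (linkConstraints β α)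
               links := s.links ∪ {(β, α)} }
  | .supportFromTask α τ => { s with commitments := s.commit α τ }
  | .supportFromAction α a =>
      { s with chronicle := s.chronicle.insert a
               commitments := s.commit α a.rootTask }
  | .post c => { s with chronicle := s.chronicle.restrict ∅ {c} }

/-- A flaw selection strategy: it selects a flaw whenever there is one. -/
def IsStrategy {O SV T : Type*} (select : SearchState O SV T → Flaw O SV T) : Prop :=
  ∀ s : SearchState O SV T, (∃ x, s.IsFlaw x) → s.Selectable (select s)

/-- `Fape P select s φ`: the nondeterministic procedure, run from the search state `s` with the
given flaw selection strategy, can return the chronicle `φ`.  A chronicle without flaws is returned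
if its constraints are consistent (it is a dead end otherwise).  If there is a flaw, one is selected
(this is not a choice point), a resolver is chosen nondeterministically, and the procedure is called
recursively; without resolvers it fails. -/
inductive Fape {O SV T : Type*} (P : Problem O SV T)
    (select : SearchState O SV T → Flaw O SV T) : SearchState O SV T → Chronicle O SV T → Prop
  | done (s : SearchState O SV T) (h : ∀ x, ¬ s.IsFlaw x)
      (hc : s.chronicle.instances.Nonempty) : Fape P select s s.chronicle
  | step (s : SearchState O SV T) (ρ : Resolver O SV T) (φ : Chronicle O SV T)
      (h : ∃ x, s.IsFlaw x) (hρ : s.IsResolver P (select s) ρ)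
      (hφ : Fape P select (s.transform ρ) φ) : Fape P select s φ

/-- The search space: the states obtained from the initial one by applying resolvers of selectable
flaws. -/
inductive InSearchSpace {O SV T : Type*} (P : Problem O SV T) : SearchState O SV T → Prop
  | initial : InSearchSpace P (SearchState.initial P)
  | step (s : SearchState O SV T) (x : Flaw O SV T) (ρ : Resolver O SV T)
      (hs : InSearchSpace P s) (hx : s.Selectable x) (hρ : s.IsResolver P x ρ) :
      InSearchSpace P (s.transform ρ)

/-- `ψ` is a solution plan that refines the search state `s`: it is reachable from the chronicle
of `s` and respects the commitments, i.e. every assertion `α` with a nonempty `DT_α` has a causal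
supporter added by an action that descends from all the tasks in `DT_α`. -/
def SearchState.IsCompletion {O SV T : Type*} (P : Problem O SV T) (s : SearchState O SV T)
    (ψ : Chronicle O SV T) : Prop :=
  IsSolution P ψ ∧ Reachable P s.chronicle ψ ∧
  ∀ α, (s.commitments α).Nonempty →
    ∃ β, ψ.Supports β α ∧ ∀ τ ∈ s.commitments α, ψ.AddedUnder τ β

/-- `ψ'` is the same plan as `ψ`, made more explicit: it is a solution plan obtained from the
solution plan `ψ` by a plan restriction (such as explicit causal links and separation constraints)
that keeps the instantiation `σ`. -/
def IsExplicitation {O SV T : Type*} (P : Problem O SV T) (σ : Assignment Name O)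
    (ψ ψ' : Chronicle O SV T) : Prop :=
  ψ.IsRestriction ψ' ∧ IsSolution P ψ' ∧ σ ∈ ψ'.instances

end FAPE

namespace FAPE

/-! ## Renaming of variables -/

section Renaming

variable {N M O SV T : Type*}

/-! Soundness is an invariant argument. Each recorded link keeps its persistence and its constraints
in the chronicle, so its producer supports both the linked assertion (`supports_of_link`) and the
persistence itself (`supports_causalLink`). When no flaw is left, every assertion is an assignment,
a causal link or the target of a link, and no instantiation has a conflict; this is what a solution
plan requires (`WellFormed.isSolution`).

Completeness follows from coverage. Fix a completion `ψ` and an instantiation `σ`; a resolver of any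
selectable flaw can be read off from them. An unrefined task is refined as in `ψ`. Two requirements
that do not conflict under `σ` satisfy a separation constraint under `σ` (`exists_separation`). An
unsupported assertion has a supporter in `ψ`, which is either already in the chronicle and can be
linked, or was added by a new action, below an unrefined task or below a later inserted root action.
In the last two cases the chain of refinements in `ψ`, evaluated at `σ`, witnesses the possible
effect, and the observed delay bounds the minimal one (`AddedUnder.possibleEffect`). All commitments
are respected because tasks above the same action are comparable (`Descends.comparable`).

After the resolver, a completion must still be reachable. Refinements and insertions that occur on
the way to `ψ` can be moved to the front (`refine_first`, `insert_first`). Links and separation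
constraints can be added to the state and to `ψ` at once (`restrict_both`), and the enlarged `ψ` is
still a solution (`IsSolution.link`, `IsSolution.post`): a link requires only what some assertion of
`ψ` already requires at each of its times.

The procedure terminates along these choices because each resolver decreases a lexicographic rank:
actions still to be added, assertions without link, commitments still possible, conflicts still
possible. -/

theorem ObjTerm.eval_map (f : N → M) (σ : Assignment M O) (x : ObjTerm N O) :
    (x.map f).eval σ = x.eval (σ.comap f) := by
  cases x <;> rfl

theorem ObjTerm.map_eval_map (f : N → M) (σ : Assignment M O) (xs : List (ObjTerm N O)) :
    (xs.map (ObjTerm.map f)).map (ObjTerm.eval σ) = xs.map (ObjTerm.eval (σ.comap f)) := by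
  simp [ObjTerm.eval_map]

theorem Assignment.val_map (f : N → M) (σ : Assignment M O) (x : Var N) :
    σ.val (x.map f) = (σ.comap f).val x := by
  cases x <;> rfl

theorem TimeTerm.eval_map (f : N → M) (σ : Assignment M O) (t : TimeTerm N) :
    (t.map f).eval σ = t.eval (σ.comap f) := rfl

theorem Constraint.sat_map (f : N → M) (σ : Assignment M O) (c : Constraint N O) :
    (c.map f).Sat σ ↔ c.Sat (σ.comap f) := by
  cases c <;>
    simp [Constraint.map, Constraint.Sat, ObjTerm.eval_map, TimeTerm.eval_map, Function.comp_def,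
      Assignment.val_map]

theorem StateVar.eval_map (f : N → M) (σ : Assignment M O) (x : StateVar N O SV) :
    (x.map f).eval σ = x.eval (σ.comap f) := by
  simp [StateVar.map, StateVar.eval, ObjTerm.eval_map]

theorem Assertion.wellTimed_map (f : N → M) (σ : Assignment M O) (α : Assertion N O SV) :
    (α.map f).WellTimed σ ↔ α.WellTimed (σ.comap f) := by
  cases α <;> rfl

theorem Assertion.finish_map (f : N → M) (α : Assertion N O SV) :
    (α.map f).finish = α.finish.map f := by
  cases α <;> rfl

theorem Assertion.produces_map (f : N → M) (σ : Assignment M O) (α : Assertion N O SV)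
    (g : Fluent O SV) : (α.map f).Produces σ g ↔ α.Produces (σ.comap f) g := by
  cases α <;>
    simp [Assertion.map, Assertion.Produces, Assertion.produces, Assertion.stateVar,
      StateVar.eval_map, ObjTerm.eval_map]

theorem ObjTerm.names_map (f : N → M) (x : ObjTerm N O) : (x.map f).names ⊆ Set.range f := by
  cases x <;> simp [ObjTerm.map, ObjTerm.names]

theorem ObjTerm.names_map_list (f : N → M) (xs : List (ObjTerm N O)) {y : ObjTerm M O}
    (hy : y ∈ xs.map (ObjTerm.map f)) : y.names ⊆ Set.range f := by
  obtain ⟨x, -, rfl⟩ := List.mem_map.1 hy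
  exact x.names_map f

theorem StateVar.names_map (f : N → M) (x : StateVar N O SV) :
    (x.map f).names ⊆ Set.range f := by
  rintro n ⟨y, hy, hn⟩
  exact ObjTerm.names_map_list f _ hy hn

theorem Var.name_map (f : N → M) (x : Var N) : (x.map f).name = f x.name := by
  cases x <;> rfl

theorem Constraint.names_map (f : N → M) (c : Constraint N O) :
    (c.map f).names ⊆ Set.range f := by
  cases c with
  | rel xs γ =>
    rintro n ⟨x, hx, rfl⟩
    obtain ⟨y, -, rfl⟩ := List.mem_map.1 hx
    exact ⟨_, (Var.name_map f y).symm⟩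
  | objEq xs ys =>
    rintro n ⟨x, hx, hn⟩
    rw [← List.map_append] at hx
    exact ObjTerm.names_map_list f _ hx hn
  | objNe x y => exact Set.union_subset (x.names_map f) (y.names_map f)
  | timeEq s t => rintro n (rfl | rfl) <;> exact ⟨_, rfl⟩
  | timeLe s t => rintro n (rfl | rfl) <;> exact ⟨_, rfl⟩
  | timeLt s t => rintro n (rfl | rfl) <;> exact ⟨_, rfl⟩

theorem Assertion.names_map (f : N → M) (α : Assertion N O SV) :
    (α.map f).names ⊆ Set.range f := by
  cases α with
  | persistence s e sv v =>
    refine Set.union_subset (Set.union_subset ?_ (sv.names_map f)) (v.names_map f)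
    rintro n (rfl | rfl) <;> exact ⟨_, rfl⟩
  | change s e sv v w =>
    refine Set.union_subset (Set.union_subset (Set.union_subset ?_ (sv.names_map f))
      (v.names_map f)) (w.names_map f)
    rintro n (rfl | rfl) <;> exact ⟨_, rfl⟩
  | assign t sv v =>
    refine Set.union_subset (Set.union_subset ?_ (sv.names_map f)) (v.names_map f)
    rintro n rfl; exact ⟨_, rfl⟩

theorem Task.names_map (f : N → M) (τ : Task N O T) : (τ.map f).names ⊆ Set.range f := by
  refine Set.union_subset ?_ ?_
  · rintro n (rfl | rfl) <;> exact ⟨_, rfl⟩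
  · rintro n ⟨y, hy, hn⟩
    exact ObjTerm.names_map_list f _ hy hn

theorem Task.start_mem_names (τ : Task N O T) : τ.start.var ∈ τ.names := by
  simp [Task.names]

theorem Assertion.finish_mem_names (α : Assertion N O SV) : α.finish.var ∈ α.names := by
  cases α <;> simp [Assertion.names, Assertion.finish]

theorem Assertion.start_mem_names (α : Assertion N O SV) : α.start.var ∈ α.names := by
  cases α <;> simp [Assertion.names, Assertion.start]

theorem Assertion.stateVar_names_subset (α : Assertion N O SV) : α.stateVar.names ⊆ α.names := by
  cases α <;> intro n hn <;> simp [Assertion.names, Assertion.stateVar] at hn ⊢ <;> tauto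

theorem Assertion.needs_names_subset {α : Assertion N O SV} {v : ObjTerm N O}
    (h : α.needs = some v) : v.names ⊆ α.names := by
  cases α <;> intro n hn <;> simp [Assertion.names, Assertion.needs] at h ⊢ <;> subst h <;> tauto

theorem Assertion.produces_names_subset {α : Assertion N O SV} {v : ObjTerm N O}
    (h : α.produces = some v) : v.names ⊆ α.names := by
  cases α <;> intro n hn <;> simp [Assertion.names, Assertion.produces] at h ⊢ <;> subst h <;> tauto

end Renaming

/-! ### Variables owned by an action instance -/

namespace Action

variable {O SV T : Type*}

theorem fst_of_mem_range_rename {a : Action O SV T} {n : Name} (h : n ∈ Set.range a.rename) :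
    n.1 = some a.id := by
  obtain ⟨m, rfl⟩ := h
  rfl

theorem fst_of_mem_assertion_names {a : Action O SV T} {α : Assertion Name O SV}
    (h : α ∈ a.assertions) {n : Name} (hn : n ∈ α.names) : n.1 = some a.id := by
  obtain ⟨β, -, rfl⟩ := h
  exact fst_of_mem_range_rename (β.names_map _ hn)

theorem fst_of_mem_constraint_names {a : Action O SV T} {c : Constraint Name O}
    (h : c ∈ a.constraints) {n : Name} (hn : n ∈ c.names) : n.1 = some a.id := by
  obtain ⟨c', -, rfl⟩ := h
  exact fst_of_mem_range_rename (c'.names_map _ hn)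

theorem fst_of_mem_subtask_names {a : Action O SV T} {τ : PlanTask O T}
    (h : τ ∈ a.subtasks) {n : Name} (hn : n ∈ τ.task.names) : n.1 = some a.id := by
  obtain ⟨t, -, rfl⟩ := h
  exact fst_of_mem_range_rename (t.names_map _ hn)

theorem fst_of_mem_task_names {a : Action O SV T} {n : Name} (hn : n ∈ a.task.names) :
    n.1 = some a.id :=
  fst_of_mem_range_rename (Task.names_map _ _ hn)

theorem origin_of_mem_subtasks {a : Action O SV T} {τ : PlanTask O T} (h : τ ∈ a.subtasks) :
    τ.origin = .sub a.id := by
  obtain ⟨t, -, rfl⟩ := h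
  rfl

theorem mem_names_of_mem_unifyTask {a : Action O SV T} {τ : PlanTask O T} {c : Constraint Name O}
    (h : c ∈ a.unifyTask τ) {n : Name} (hn : n ∈ c.names) :
    n ∈ a.task.names ∨ n ∈ τ.task.names := by
  rcases h with rfl | rfl | rfl
  · obtain ⟨x, hx, hn⟩ := hn
    rcases List.mem_append.1 hx with hx | hx
    · exact .inl (.inr ⟨x, hx, hn⟩)
    · exact .inr (.inr ⟨x, hx, hn⟩)
  · rcases hn with rfl | rfl
    · exact .inl (.inl (.inl rfl))
    · exact .inr (.inl (.inl rfl))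
  · rcases hn with rfl | rfl
    · exact .inl (.inl (.inr rfl))
    · exact .inr (.inl (.inr rfl))

/-- When `τ` is refined it leaves the chronicle, but its variables stay visible in the unification
constraints. Hence freshness can be pulled back to earlier chronicles. -/
theorem exists_mem_unifyTask_of_mem_names (a : Action O SV T) {τ : PlanTask O T} {n : Name}
    (hn : n ∈ τ.task.names) : ∃ c ∈ a.unifyTask τ, n ∈ c.names := by
  rcases hn with (rfl | rfl) | ⟨y, hy, hn⟩
  · exact ⟨_, .inr (.inl rfl), .inr rfl⟩
  · exact ⟨_, .inr (.inr rfl), .inr rfl⟩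
  · exact ⟨_, .inl rfl, y, List.mem_append_right _ hy, hn⟩

theorem finite_assertions (a : Action O SV T) : a.assertions.Finite :=
  (a.template.assertions.finite_toSet.image fun α => α.map a.rename).subset
    fun _ ⟨α, hα, h⟩ => ⟨α, hα, h.symm⟩

theorem isInstance_comap {a : Action O SV T} {φ : Chronicle O SV T} {σ : Assignment Name O}
    (hσ : σ ∈ φ.instances) (hF : a.assertions ⊆ φ.assertions)
    (hC : a.constraints ⊆ φ.constraints) : a.template.IsInstance (σ.comap a.rename) :=
  ⟨fun c hc => (c.sat_map _ _).1 (hσ.1 _ (hC ⟨c, hc, rfl⟩)),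
    fun α hα => (α.wellTimed_map _ _).1 (hσ.2 _ (hF ⟨α, hα, rfl⟩))⟩

end Action
end FAPE

namespace FAPE

/-! ## Invariants of plan transformations -/

namespace Chronicle

variable {O SV T : Type*} {P : Problem O SV T} {φ ψ χ : Chronicle O SV T}

/-- `ψ` contains everything that `φ` contains, except that tasks may have been refined; the
variables of the refined tasks then occur in the constraints of `ψ`. -/
structure Extends (φ ψ : Chronicle O SV T) : Prop where
  actions : φ.actions ⊆ ψ.actions
  refinements : φ.refinements ⊆ ψ.refinements
  assertions : φ.assertions ⊆ ψ.assertions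
  constraints : φ.constraints ⊆ ψ.constraints
  tasks : ∀ τ ∈ φ.tasks, τ ∈ ψ.tasks ∨
    ((∃ a, (τ, a) ∈ ψ.refinements) ∧ ∀ n ∈ τ.task.names, ∃ c ∈ ψ.constraints, n ∈ c.names)

theorem Extends.refl (φ : Chronicle O SV T) : φ.Extends φ :=
  ⟨subset_rfl, subset_rfl, subset_rfl, subset_rfl, fun _ h => .inl h⟩

theorem Extends.trans (h : φ.Extends ψ) (h' : ψ.Extends χ) : φ.Extends χ where
  actions := h.actions.trans h'.actions
  refinements := h.refinements.trans h'.refinements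
  assertions := h.assertions.trans h'.assertions
  constraints := h.constraints.trans h'.constraints
  tasks τ hτ := by
    rcases h.tasks τ hτ with h1 | ⟨⟨a, ha⟩, h1⟩
    · exact h'.tasks τ h1
    · refine .inr ⟨⟨a, h'.refinements ha⟩, fun n hn => ?_⟩
      obtain ⟨c, hc, hn⟩ := h1 n hn
      exact ⟨c, h'.constraints hc, hn⟩

theorem Extends.refine (φ : Chronicle O SV T) (τ : PlanTask O T) (a : Action O SV T) :
    φ.Extends (φ.refine τ a) where
  actions := Set.subset_union_left
  refinements := Set.subset_union_left
  assertions := Set.subset_union_left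
  constraints := Set.subset_union_left.trans Set.subset_union_left
  tasks τ' hτ' := by
    by_cases h : τ' = τ
    · subst h
      refine .inr ⟨⟨a, .inr rfl⟩, fun n hn => ?_⟩
      obtain ⟨c, hc, hn⟩ := a.exists_mem_unifyTask_of_mem_names hn
      exact ⟨c, .inr hc, hn⟩
    · exact .inl (.inl ⟨hτ', h⟩)

theorem Extends.insert (φ : Chronicle O SV T) (a : Action O SV T) : φ.Extends (φ.insert a) where
  actions := Set.subset_union_left
  refinements := Set.subset_union_left
  assertions := Set.subset_union_left
  constraints := Set.subset_union_left
  tasks _ hτ := .inl (.inl hτ)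

theorem Extends.restrict (φ : Chronicle O SV T) (F : Set (Assertion Name O SV))
    (C : Set (Constraint Name O)) : φ.Extends (φ.restrict F C) where
  actions := subset_rfl
  refinements := subset_rfl
  assertions := Set.subset_union_left
  constraints := Set.subset_union_left
  tasks _ hτ := .inl hτ

theorem _root_.FAPE.Transformation.extends (h : Transformation P φ ψ) : φ.Extends ψ := by
  cases h with
  | refine τ a => exact .refine φ τ a
  | insert a => exact .insert φ a
  | restrict _ h =>
    obtain ⟨F, C, -, -, -, rfl⟩ := h
    exact .restrict φ F C

theorem _root_.FAPE.Reachable.extends (h : Reachable P φ ψ) : φ.Extends ψ := by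
  induction h with
  | refl => exact .refl φ
  | tail _ h ih => exact ih.trans h.extends

/-- Nothing that carries variables disappears along an extension: a refined task leaves its
variables in the constraints. So an identifier used early is still used later. -/
theorem Fresh.of_extends {k : ℕ} (hk : ψ.Fresh k) (h : φ.Extends ψ) : φ.Fresh k := by
  refine ⟨fun a ha => hk.1 a (h.actions ha), fun τ hτ n hn => ?_,
    fun α hα => hk.2.2.1 α (h.assertions hα), fun c hc => hk.2.2.2 c (h.constraints hc)⟩
  rcases h.tasks τ hτ with h1 | ⟨-, h1⟩
  · exact hk.2.1 τ h1 n hn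
  · obtain ⟨c, hc, hn⟩ := h1 n hn
    exact hk.2.2.2 c hc n hn

theorem Extends.instances_subset (h : φ.Extends ψ) : ψ.instances ⊆ φ.instances :=
  fun _ hσ => ⟨fun c hc => hσ.1 c (h.constraints hc), fun α hα => hσ.2 α (h.assertions hα)⟩

/-- The start variable of a subtask of `a` carries the identifier of `a`, which freshness excludes
from the tasks of `φ`. -/
theorem Fresh.not_mem_subtasks {a : Action O SV T} (hk : φ.Fresh a.id) {τ : PlanTask O T}
    (hτ : τ ∈ φ.tasks) : τ ∉ a.subtasks := fun h =>
  hk.2.1 τ hτ _ τ.task.start_mem_names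
    (Action.fst_of_mem_subtask_names h τ.task.start_mem_names)

/-- The invariants of the chronicles that are reachable from an initial chronicle. -/
structure WellFormed (P : Problem O SV T) (φ : Chronicle O SV T) : Prop where
  id_inj : ∀ a ∈ φ.actions, ∀ b ∈ φ.actions, a.id = b.id → a = b
  task_origin : ∀ τ ∈ φ.tasks, ∀ k, τ.origin ≠ .root k
  mem_actions : ∀ τ a, (τ, a) ∈ φ.refinements → a ∈ φ.actions
  task_sym : ∀ τ a, (τ, a) ∈ φ.refinements → a.task.sym = τ.task.sym
  unify : ∀ τ a, (τ, a) ∈ φ.refinements →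
    τ = a.rootTask ∨ (a.unifyTask τ ⊆ φ.constraints ∧ ∀ k, τ.origin ≠ .root k)
  mem_templates : ∀ a ∈ φ.actions, a.template ∈ P.actions
  action_assertions : ∀ a ∈ φ.actions, a.assertions ⊆ φ.assertions
  action_constraints : ∀ a ∈ φ.actions, a.constraints ⊆ φ.constraints
  not_mem_tasks : ∀ τ a, (τ, a) ∈ φ.refinements → τ ∉ φ.tasks
  action_unique : ∀ τ a b, (τ, a) ∈ φ.refinements → (τ, b) ∈ φ.refinements → a = b
  task_unique : ∀ τ τ' a, (τ, a) ∈ φ.refinements → (τ', a) ∈ φ.refinements → τ = τ'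
  subtasks : ∀ a ∈ φ.actions, ∀ τ ∈ a.subtasks, τ ∈ φ.tasks ∨ ∃ b, (τ, b) ∈ φ.refinements
  finite_actions : φ.actions.Finite
  finite_refinements : φ.refinements.Finite
  finite_assertions : φ.assertions.Finite

theorem wellFormed_initial (P : Problem O SV T) : (initial P).WellFormed P where
  id_inj _ h := h.elim
  task_origin := by
    rintro _ ⟨t, -, rfl⟩ k ⟨⟩
  mem_actions _ _ h := h.elim
  task_sym _ _ h := h.elim
  unify _ _ h := h.elim
  mem_templates _ h := h.elim
  action_assertions _ h := h.elim
  action_constraints _ h := h.elim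
  not_mem_tasks _ _ h := h.elim
  action_unique _ _ _ h := h.elim
  task_unique _ _ _ h := h.elim
  subtasks _ h := h.elim
  finite_actions := Set.finite_empty
  finite_refinements := Set.finite_empty
  finite_assertions :=
    (P.assertions.finite_toSet.image fun α => α.map fun n => (none, n)).subset
      fun _ ⟨α, hα, h⟩ => ⟨α, hα, h.symm⟩

/-- A refined task is either a root, whose origin differs from that of a subtask, or it was unified
with its action, so that its start variable occurs in a constraint of `φ` and cannot belong to a
fresh `a`. -/
theorem WellFormed.not_mem_subtasks (h : φ.WellFormed P) {a b : Action O SV T}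
    (hk : φ.Fresh a.id) {τ : PlanTask O T} (hτ : (τ, b) ∈ φ.refinements) : τ ∉ a.subtasks := by
  intro hs
  rcases h.unify τ b hτ with rfl | ⟨hu, -⟩
  · cases Action.origin_of_mem_subtasks hs
  · obtain ⟨c, hc, hn⟩ := b.exists_mem_unifyTask_of_mem_names τ.task.start_mem_names
    exact hk.2.2.2 c (hu hc) _ hn
      (Action.fst_of_mem_subtask_names hs τ.task.start_mem_names)

theorem WellFormed.refine (h : φ.WellFormed P) {τ : PlanTask O T} {a : Action O SV T}
    (hτ : τ ∈ φ.tasks) (ha : a.template ∈ P.actions) (hk : φ.Fresh a.id)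
    (hsym : a.task.sym = τ.task.sym) : (φ.refine τ a).WellFormed P where
  id_inj := by
    rintro b (hb | rfl) c (hc | rfl) he
    · exact h.id_inj b hb c hc he
    · exact (hk.1 b hb he).elim
    · exact (hk.1 c hc he.symm).elim
    · rfl
  task_origin := by
    rintro τ' (hτ' | hτ') k
    · exact h.task_origin τ' hτ'.1 k
    · rw [Action.origin_of_mem_subtasks hτ']
      rintro ⟨⟩
  mem_actions := by
    rintro τ' b (hb | hb)
    · exact .inl (h.mem_actions τ' b hb)
    · cases hb; exact .inr rfl
  task_sym := by
    rintro τ' b (hb | hb)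
    · exact h.task_sym τ' b hb
    · cases hb; exact hsym
  unify := by
    rintro τ' b (hb | hb)
    · rcases h.unify τ' b hb with h1 | ⟨h1, h2⟩
      · exact .inl h1
      · exact .inr ⟨h1.trans (Extends.refine φ τ a).constraints, h2⟩
    · cases hb
      exact .inr ⟨Set.subset_union_right, h.task_origin τ hτ⟩
  mem_templates := by
    rintro b (hb | rfl)
    · exact h.mem_templates b hb
    · exact ha
  action_assertions := by
    rintro b (hb | rfl)
    · exact (h.action_assertions b hb).trans Set.subset_union_left
    · exact Set.subset_union_right
  action_constraints := by
    rintro b (hb | rfl)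
    · exact (h.action_constraints b hb).trans (Extends.refine φ τ a).constraints
    · exact Set.subset_union_right.trans Set.subset_union_left
  not_mem_tasks := by
    rintro τ' b (hb | hb) (ht | ht)
    · exact h.not_mem_tasks τ' b hb ht.1
    · exact h.not_mem_subtasks hk hb ht
    · cases hb; exact ht.2 rfl
    · cases hb; exact hk.not_mem_subtasks hτ ht
  action_unique := by
    rintro τ' b c (hb | hb) (hc | hc)
    · exact h.action_unique τ' b c hb hc
    · cases hc; exact (h.not_mem_tasks _ _ hb hτ).elim
    · cases hb; exact (h.not_mem_tasks _ _ hc hτ).elim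
    · cases hb; cases hc; rfl
  task_unique := by
    rintro τ' τ'' b (hb | hb) (hc | hc)
    · exact h.task_unique τ' τ'' b hb hc
    · cases hc; exact (hk.1 _ (h.mem_actions _ _ hb) rfl).elim
    · cases hb; exact (hk.1 _ (h.mem_actions _ _ hc) rfl).elim
    · cases hb; cases hc; rfl
  subtasks := by
    rintro b (hb | rfl) τ' hτ'
    · rcases h.subtasks b hb τ' hτ' with h1 | ⟨c, hc⟩
      · by_cases he : τ' = τ
        · exact .inr ⟨a, .inr (by rw [he]; rfl)⟩
        · exact .inl (.inl ⟨h1, he⟩)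
      · exact .inr ⟨c, .inl hc⟩
    · exact .inl (.inr hτ')
  finite_actions := h.finite_actions.union (Set.finite_singleton _)
  finite_refinements := h.finite_refinements.union (Set.finite_singleton _)
  finite_assertions := h.finite_assertions.union a.finite_assertions

theorem WellFormed.insert (h : φ.WellFormed P) {a : Action O SV T}
    (ha : a.template ∈ P.actions) (hk : φ.Fresh a.id) : (φ.insert a).WellFormed P where
  id_inj := by
    rintro b (hb | rfl) c (hc | rfl) he
    · exact h.id_inj b hb c hc he
    · exact (hk.1 b hb he).elim
    · exact (hk.1 c hc he.symm).elim
    · rfl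
  task_origin := by
    rintro τ' (hτ' | hτ') k
    · exact h.task_origin τ' hτ' k
    · rw [Action.origin_of_mem_subtasks hτ']
      rintro ⟨⟩
  mem_actions := by
    rintro τ' b (hb | hb)
    · exact .inl (h.mem_actions τ' b hb)
    · cases hb; exact .inr rfl
  task_sym := by
    rintro τ' b (hb | hb)
    · exact h.task_sym τ' b hb
    · cases hb; rfl
  unify := by
    rintro τ' b (hb | hb)
    · rcases h.unify τ' b hb with h1 | ⟨h1, h2⟩
      · exact .inl h1
      · exact .inr ⟨h1.trans Set.subset_union_left, h2⟩
    · cases hb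
      exact .inl rfl
  mem_templates := by
    rintro b (hb | rfl)
    · exact h.mem_templates b hb
    · exact ha
  action_assertions := by
    rintro b (hb | rfl)
    · exact (h.action_assertions b hb).trans Set.subset_union_left
    · exact Set.subset_union_right
  action_constraints := by
    rintro b (hb | rfl)
    · exact (h.action_constraints b hb).trans Set.subset_union_left
    · exact Set.subset_union_right
  not_mem_tasks := by
    rintro τ' b (hb | hb) (ht | ht)
    · exact h.not_mem_tasks τ' b hb ht
    · exact h.not_mem_subtasks hk hb ht
    · cases hb; exact h.task_origin _ ht _ rfl
    · cases hb; cases Action.origin_of_mem_subtasks ht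
  action_unique := by
    -- A recorded root task carries the identifier of the action that it refines to, so the root
    -- task of a fresh action is not recorded yet.
    have key : ∀ b, (a.rootTask, b) ∉ φ.refinements := by
      intro b hb
      rcases h.unify _ b hb with h1 | ⟨-, h1⟩
      · have h2 : a.id = b.id := by injection congrArg PlanTask.origin h1
        exact hk.1 b (h.mem_actions _ b hb) h2.symm
      · exact h1 _ rfl
    rintro τ' b c (hb | hb) (hc | hc)
    · exact h.action_unique τ' b c hb hc
    · cases hc; exact (key b hb).elim
    · cases hb; exact (key c hc).elim
    · cases hb; cases hc; rfl
  task_unique := by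
    rintro τ' τ'' b (hb | hb) (hc | hc)
    · exact h.task_unique τ' τ'' b hb hc
    · cases hc; exact (hk.1 _ (h.mem_actions _ _ hb) rfl).elim
    · cases hb; exact (hk.1 _ (h.mem_actions _ _ hc) rfl).elim
    · cases hb; cases hc; rfl
  subtasks := by
    rintro b (hb | rfl) τ' hτ'
    · rcases h.subtasks b hb τ' hτ' with h1 | ⟨c, hc⟩
      · exact .inl (.inl h1)
      · exact .inr ⟨c, .inl hc⟩
    · exact .inl (.inr hτ')
  finite_actions := h.finite_actions.union (Set.finite_singleton _)
  finite_refinements := h.finite_refinements.union (Set.finite_singleton _)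
  finite_assertions := h.finite_assertions.union a.finite_assertions

theorem WellFormed.restrict (h : φ.WellFormed P) {F : Set (Assertion Name O SV)}
    {C : Set (Constraint Name O)} (hF : F.Finite) : (φ.restrict F C).WellFormed P where
  id_inj := h.id_inj
  task_origin := h.task_origin
  mem_actions := h.mem_actions
  task_sym := h.task_sym
  unify τ a ha := (h.unify τ a ha).imp_right fun h1 => ⟨h1.1.trans Set.subset_union_left, h1.2⟩
  mem_templates := h.mem_templates
  action_assertions a ha := (h.action_assertions a ha).trans Set.subset_union_left
  action_constraints a ha := (h.action_constraints a ha).trans Set.subset_union_left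
  not_mem_tasks := h.not_mem_tasks
  action_unique := h.action_unique
  task_unique := h.task_unique
  subtasks := h.subtasks
  finite_actions := h.finite_actions
  finite_refinements := h.finite_refinements
  finite_assertions := h.finite_assertions.union hF

theorem WellFormed.of_transformation (h : φ.WellFormed P) (ht : Transformation P φ ψ) :
    ψ.WellFormed P := by
  cases ht with
  | refine τ a hτ ha hk hsym => exact h.refine hτ ha hk hsym
  | insert a ha hk _ => exact h.insert ha hk
  | restrict _ hr =>
    obtain ⟨F, C, hF, -, -, rfl⟩ := hr
    exact h.restrict hF

theorem WellFormed.of_reachable (h : φ.WellFormed P) (hr : Reachable P φ ψ) :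
    ψ.WellFormed P := by
  induction hr with
  | refl => exact h
  | tail _ ht ih => exact ih.of_transformation ht

/-! ## Exchanging transformations -/

/-- All variables of `F` and `C` occur in the assertions of `φ`. -/
def Covers (φ : Chronicle O SV T) (F : Set (Assertion Name O SV)) (C : Set (Constraint Name O)) :
    Prop :=
  (∀ α ∈ F, ∀ n ∈ α.names, ∃ γ ∈ φ.assertions, n ∈ γ.names) ∧
  ∀ c ∈ C, ∀ n ∈ c.names, ∃ γ ∈ φ.assertions, n ∈ γ.names

theorem Covers.mono {F : Set (Assertion Name O SV)} {C : Set (Constraint Name O)}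
    (h : φ.Covers F C) (h' : φ.Extends ψ) : ψ.Covers F C :=
  ⟨fun α hα n hn => (h.1 α hα n hn).imp fun _ hγ => ⟨h'.assertions hγ.1, hγ.2⟩,
    fun c hc n hn => (h.2 c hc n hn).imp fun _ hγ => ⟨h'.assertions hγ.1, hγ.2⟩⟩

/-- A restriction whose variables all occur in assertions of `φ` uses no new identifier. Without
`Covers` it could mention variables of an action that is added only later. -/
theorem Fresh.restrict {F : Set (Assertion Name O SV)} {C : Set (Constraint Name O)} {k : ℕ}
    (hk : φ.Fresh k) (h : φ.Covers F C) : (φ.restrict F C).Fresh k := by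
  refine ⟨hk.1, hk.2.1, ?_, ?_⟩
  · rintro α (hα | hα) n hn
    · exact hk.2.2.1 α hα n hn
    · obtain ⟨γ, hγ, hn⟩ := h.1 α hα n hn
      exact hk.2.2.1 γ hγ n hn
  · rintro c (hc | hc) n hn
    · exact hk.2.2.2 c hc n hn
    · obtain ⟨γ, hγ, hn⟩ := h.2 c hc n hn
      exact hk.2.2.1 γ hγ n hn

theorem Fresh.refine {k : ℕ} (hk : φ.Fresh k) {τ : PlanTask O T} (hτ : τ ∈ φ.tasks)
    {a : Action O SV T} (ha : a.id ≠ k) : (φ.refine τ a).Fresh k := by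
  have ne : ∀ {n : Name}, n.1 = some a.id → n.1 ≠ some k := fun h h' =>
    ha (Option.some_injective _ (h.symm.trans h'))
  refine ⟨?_, ?_, ?_, ?_⟩
  · rintro b (hb | rfl)
    · exact hk.1 b hb
    · exact ha
  · rintro τ' (hτ' | hτ') n hn
    · exact hk.2.1 τ' hτ'.1 n hn
    · exact ne (Action.fst_of_mem_subtask_names hτ' hn)
  · rintro α (hα | hα) n hn
    · exact hk.2.2.1 α hα n hn
    · exact ne (Action.fst_of_mem_assertion_names hα hn)
  · rintro c ((hc | hc) | hc) n hn
    · exact hk.2.2.2 c hc n hn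
    · exact ne (Action.fst_of_mem_constraint_names hc hn)
    · rcases Action.mem_names_of_mem_unifyTask hc hn with h | h
      · exact ne (Action.fst_of_mem_task_names h)
      · exact hk.2.1 τ hτ n h

theorem Fresh.insert {k : ℕ} (hk : φ.Fresh k) {a : Action O SV T} (ha : a.id ≠ k) :
    (φ.insert a).Fresh k := by
  have ne : ∀ {n : Name}, n.1 = some a.id → n.1 ≠ some k := fun h h' =>
    ha (Option.some_injective _ (h.symm.trans h'))
  refine ⟨?_, ?_, ?_, ?_⟩
  · rintro b (hb | rfl)
    · exact hk.1 b hb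
    · exact ha
  · rintro τ' (hτ' | hτ') n hn
    · exact hk.2.1 τ' hτ' n hn
    · exact ne (Action.fst_of_mem_subtask_names hτ' hn)
  · rintro α (hα | hα) n hn
    · exact hk.2.2.1 α hα n hn
    · exact ne (Action.fst_of_mem_assertion_names hα hn)
  · rintro c (hc | hc) n hn
    · exact hk.2.2.2 c hc n hn
    · exact ne (Action.fst_of_mem_constraint_names hc hn)

theorem ext {φ ψ : Chronicle O SV T} (h1 : φ.actions = ψ.actions) (h2 : φ.tasks = ψ.tasks)
    (h3 : φ.refinements = ψ.refinements) (h4 : φ.assertions = ψ.assertions)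
    (h5 : φ.constraints = ψ.constraints) : φ = ψ := by
  cases φ; cases ψ; simp_all

theorem refine_restrict (φ : Chronicle O SV T) (τ : PlanTask O T) (a : Action O SV T)
    (F : Set (Assertion Name O SV)) (C : Set (Constraint Name O)) :
    (φ.refine τ a).restrict F C = (φ.restrict F C).refine τ a :=
  ext rfl rfl rfl (Set.union_right_comm _ _ _) (by
    simp only [Chronicle.refine, Chronicle.restrict]
    ac_rfl)

theorem insert_restrict (φ : Chronicle O SV T) (a : Action O SV T)
    (F : Set (Assertion Name O SV)) (C : Set (Constraint Name O)) :
    (φ.insert a).restrict F C = (φ.restrict F C).insert a :=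
  ext rfl rfl rfl (Set.union_right_comm _ _ _) (Set.union_right_comm _ _ _)

theorem restrict_restrict (φ : Chronicle O SV T) (F F' : Set (Assertion Name O SV))
    (C C' : Set (Constraint Name O)) :
    (φ.restrict F C).restrict F' C' = φ.restrict (F ∪ F') (C ∪ C') :=
  ext rfl rfl rfl (Set.union_assoc _ _ _) (Set.union_assoc _ _ _)

theorem restrict_right_comm (φ : Chronicle O SV T) (F F' : Set (Assertion Name O SV))
    (C C' : Set (Constraint Name O)) :
    (φ.restrict F C).restrict F' C' = (φ.restrict F' C').restrict F C :=
  ext rfl rfl rfl (Set.union_right_comm _ _ _) (Set.union_right_comm _ _ _)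

/-- The orders could differ only on `τ`: if it were a subtask of `b`, inserting `b` last would bring
it back as an unrefined task. -/
theorem refine_insert (φ : Chronicle O SV T) {τ : PlanTask O T} (a b : Action O SV T)
    (hb : τ ∉ b.subtasks) : (φ.refine τ a).insert b = (φ.insert b).refine τ a := by
  refine ext (Set.union_right_comm _ _ _) ?_ (Set.union_right_comm _ _ _)
    (Set.union_right_comm _ _ _) ?_
  · ext x
    by_cases hx : x = τ
    · subst hx
      simp [Chronicle.refine, Chronicle.insert, hb]
    · simp [Chronicle.refine, Chronicle.insert, hx]
      tauto
  · simp only [Chronicle.refine, Chronicle.insert]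
    ac_rfl

theorem insert_insert (φ : Chronicle O SV T) (a b : Action O SV T) :
    (φ.insert a).insert b = (φ.insert b).insert a :=
  ext (Set.union_right_comm _ _ _) (Set.union_right_comm _ _ _) (Set.union_right_comm _ _ _)
    (Set.union_right_comm _ _ _) (Set.union_right_comm _ _ _)

theorem refine_refine (φ : Chronicle O SV T) {τ τ' : PlanTask O T} (a b : Action O SV T)
    (hb : τ ∉ b.subtasks) (ha : τ' ∉ a.subtasks) :
    (φ.refine τ a).refine τ' b = (φ.refine τ' b).refine τ a := by
  refine ext (Set.union_right_comm _ _ _) ?_ (Set.union_right_comm _ _ _)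
    (Set.union_right_comm _ _ _) ?_
  · ext x
    by_cases hx : x = τ
    · subst hx
      by_cases hx' : x = τ'
      · subst hx'
        simp [Chronicle.refine, ha, hb]
      · simp [Chronicle.refine, hb, hx']
    · by_cases hx' : x = τ'
      · subst hx'
        simp [Chronicle.refine, hx, ha]
      · simp [Chronicle.refine, hx, hx']
        tauto
  · simp only [Chronicle.refine]
    ac_rfl

theorem _root_.FAPE.Transformation.restrict_both {F : Set (Assertion Name O SV)}
    {C : Set (Constraint Name O)} (h : Transformation P φ ψ) (hc : φ.Covers F C) :
    Transformation P (φ.restrict F C) (ψ.restrict F C) := by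
  cases h with
  | refine τ a hτ ha hk hsym =>
    rw [refine_restrict]
    exact .refine _ τ a hτ ha (hk.restrict hc) hsym
  | insert a ha hk hf =>
    rw [insert_restrict]
    exact .insert _ a ha (hk.restrict hc) hf
  | restrict _ hr =>
    obtain ⟨F', C', hF, hC, hp, rfl⟩ := hr
    rw [restrict_right_comm]
    exact .restrict _ _ ⟨F', C', hF, hC, hp, rfl⟩

/-- This keeps the target reachable when a link or a constraint is added to a search state: the same
restriction is applied to both ends of the path. -/
theorem _root_.FAPE.Reachable.restrict_both {F : Set (Assertion Name O SV)}
    {C : Set (Constraint Name O)} (h : Reachable P φ ψ) (hc : φ.Covers F C) :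
    Reachable P (φ.restrict F C) (ψ.restrict F C) := by
  induction h with
  | refl => exact .refl
  | tail h ht ih => exact ih.tail (ht.restrict_both (hc.mono (Reachable.extends h)))

/-- A task that is refined on the way to `ψ` can be refined first. -/
theorem _root_.FAPE.Reachable.refine_first (h : Reachable P φ ψ) {τ : PlanTask O T}
    (hτ : τ ∈ φ.tasks) (hτ' : τ ∉ ψ.tasks) :
    ∃ a, a.template ∈ P.actions ∧ φ.Fresh a.id ∧ a.task.sym = τ.task.sym ∧
      Reachable P (φ.refine τ a) ψ := by
  induction h using Relation.ReflTransGen.head_induction_on with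
  | refl => exact (hτ' hτ).elim
  | @head φ χ ht hr ih =>
    have hx := ht.extends
    cases ht with
    | refine τ₁ b hτ₁ hb hk hsym =>
      by_cases he : τ = τ₁
      · subst he
        exact ⟨b, hb, hk, hsym, hr⟩
      obtain ⟨a, ha, hka, hsa, hra⟩ := ih (.inl ⟨hτ, he⟩)
      have hka' := hka.of_extends hx
      refine ⟨a, ha, hka', hsa, .head ?_ hra⟩
      -- The first transformation of the path refines another task. It is exchanged with the
      -- refinement of `τ`; the identifiers of `a` and `b` differ because that of `a` is fresh after
      -- `b` was added.
      rw [← refine_refine φ a b (hk.not_mem_subtasks hτ) (hka'.not_mem_subtasks hτ₁)]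
      exact .refine _ τ₁ b (.inl ⟨hτ₁, Ne.symm he⟩) hb
        (hk.refine hτ fun h => hka.1 b (.inr rfl) h.symm) hsym
    | insert b hb hk hf =>
      obtain ⟨a, ha, hka, hsa, hra⟩ := ih (.inl hτ)
      refine ⟨a, ha, hka.of_extends hx, hsa, .head ?_ hra⟩
      rw [← refine_insert φ a b (hk.not_mem_subtasks hτ)]
      exact .insert _ b hb (hk.refine hτ fun h => hka.1 b (.inr rfl) h.symm) hf
    | restrict _ hres =>
      obtain ⟨F, C, hF, hC, hp, rfl⟩ := hres
      obtain ⟨a, ha, hka, hsa, hra⟩ := ih hτ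
      refine ⟨a, ha, hka.of_extends hx, hsa, .head ?_ hra⟩
      rw [← refine_restrict]
      exact .restrict _ _ ⟨F, C, hF, hC, hp, rfl⟩

/-- An action that is inserted on the way to `ψ` can be inserted first. -/
theorem _root_.FAPE.Reachable.insert_first (h : Reachable P φ ψ) (hφ : φ.WellFormed P)
    {a : Action O SV T} (ha : (a.rootTask, a) ∉ φ.refinements)
    (ha' : (a.rootTask, a) ∈ ψ.refinements) :
    a.template ∈ P.actions ∧ ¬ a.template.dependent ∧ φ.Fresh a.id ∧
      Reachable P (φ.insert a) ψ := by
  induction h using Relation.ReflTransGen.head_induction_on with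
  | refl => exact (ha ha').elim
  | @head φ χ ht hr ih =>
    have hx := ht.extends
    have hχ := hφ.of_transformation ht
    cases ht with
    | refine τ b hτ hb hk hsym =>
      -- Refining `τ` cannot record the root task of `a`, since unrefined tasks never have a root as
      -- origin.
      obtain ⟨hta, hfa, hka, hra⟩ := ih hχ (by
        rintro (h | h)
        · exact ha h
        · cases h
          exact hφ.task_origin _ hτ _ rfl)
      have hka' := hka.of_extends hx
      refine ⟨hta, hfa, hka', .head ?_ hra⟩
      rw [refine_insert φ b a (hka'.not_mem_subtasks hτ)]
      exact .refine _ τ b (.inl hτ) hb (hk.insert fun h => hka.1 b (.inr rfl) h.symm) hsym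
    | insert b hb hk hf =>
      by_cases he : a = b
      · subst he
        exact ⟨hb, hf, hk, hr⟩
      obtain ⟨hta, hfa, hka, hra⟩ := ih hχ (by
        rintro (h | h)
        · exact ha h
        · exact he (congrArg Prod.snd h))
      refine ⟨hta, hfa, hka.of_extends hx, .head ?_ hra⟩
      rw [insert_insert]
      exact .insert _ b hb (hk.insert fun h => hka.1 b (.inr rfl) h.symm) hf
    | restrict _ hres =>
      obtain ⟨F, C, hF, hC, hp, rfl⟩ := hres
      obtain ⟨hta, hfa, hka, hra⟩ := ih hχ ha
      refine ⟨hta, hfa, hka.of_extends hx, .head ?_ hra⟩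
      rw [← insert_restrict]
      exact .restrict _ _ ⟨F, C, hF, hC, hp, rfl⟩

end Chronicle
end FAPE

namespace FAPE

/-! ## Refinement trees -/

namespace Chronicle

variable {O SV T : Type*} {P : Problem O SV T} {φ ψ χ : Chronicle O SV T}

theorem Descends.mono {τ : PlanTask O T} {a : Action O SV T} (h : φ.Descends τ a)
    (hr : φ.refinements ⊆ ψ.refinements) : ψ.Descends τ a := by
  induction h with
  | base a h => exact .base a (hr h)
  | step b a τ' _ hτ' h ih => exact .step b a τ' ih hτ' (hr h)

theorem Descends.mem_actions {τ : PlanTask O T} {a : Action O SV T} (h : φ.Descends τ a)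
    (hφ : φ.WellFormed P) : a ∈ φ.actions := by
  cases h with
  | base _ h => exact hφ.mem_actions _ _ h
  | step b _ τ' _ _ h => exact hφ.mem_actions _ _ h

/-- Two tasks with a common descendant are comparable. -/
theorem Descends.comparable (hφ : φ.WellFormed P) {τ τ' : PlanTask O T} {a : Action O SV T}
    (h : φ.Descends τ a) (h' : φ.Descends τ' a) :
    τ = τ' ∨ φ.TaskDescends τ τ' ∨ φ.TaskDescends τ' τ := by
  induction h with
  | base a h =>
    cases h' with
    | base _ h' => exact .inl (hφ.task_unique _ _ _ h h')
    | step b _ τ₁ hb hτ₁ h₁ =>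
      obtain rfl := hφ.task_unique _ _ _ h h₁
      exact .inr (.inr ⟨b, hb, hτ₁⟩)
  | step b a τ₁ hb hτ₁ h ih =>
    cases h' with
    | base _ h' =>
      obtain rfl := hφ.task_unique _ _ _ h h'
      exact .inr (.inl ⟨b, hb, hτ₁⟩)
    | step c _ τ₂ hc hτ₂ h' =>
      obtain rfl := hφ.task_unique _ _ _ h h'
      -- The origin of a task names the action of which it is a subtask, so the two chains have the
      -- same parent action and continue upwards together.
      have he : Origin.sub b.id = .sub c.id :=
        (Action.origin_of_mem_subtasks hτ₁).symm.trans (Action.origin_of_mem_subtasks hτ₂)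
      obtain rfl := hφ.id_inj b (hb.mem_actions hφ) c (hc.mem_actions hφ) (by injection he)
      exact ih hc

/-- A refinement is recorded exactly when its action enters with a fresh identifier, and this
freshness goes back to `φ` by `Fresh.of_extends`. -/
theorem _root_.FAPE.Reachable.fresh_of_not_mem (h : Reachable P φ ψ) {τ : PlanTask O T}
    {a : Action O SV T} (ha : (τ, a) ∈ ψ.refinements) (ha' : (τ, a) ∉ φ.refinements) :
    φ.Fresh a.id := by
  induction h with
  | refl => exact (ha' ha).elim
  | tail h ht ih =>
    cases ht with
    | refine τ' b _ _ hk _ =>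
      rcases ha with ha | ha
      · exact ih ha
      · cases ha
        exact hk.of_extends (Reachable.extends h)
    | insert b _ hk _ =>
      rcases ha with ha | ha
      · exact ih ha
      · cases ha
        exact hk.of_extends (Reachable.extends h)
    | restrict _ hr =>
      obtain ⟨F, C, -, -, -, rfl⟩ := hr
      exact ih ha

/-- Besides actions, only plan restrictions add assertions, and these are persistences. As
persistences produce nothing, a supporter that is not in `φ` must come from an action. -/
theorem _root_.FAPE.Reachable.assertion_cases (h : Reachable P φ ψ) {β : Assertion Name O SV}
    (hβ : β ∈ ψ.assertions) :
    β ∈ φ.assertions ∨ β.IsPersistence ∨ ∃ b ∈ ψ.actions, β ∈ b.assertions := by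
  induction h with
  | refl => exact .inl hβ
  | @tail ψ χ _ ht ih =>
    have key : β ∈ ψ.assertions →
        β ∈ φ.assertions ∨ β.IsPersistence ∨ ∃ b ∈ χ.actions, β ∈ b.assertions := fun h =>
      (ih h).imp_right fun h' => h'.imp_right
        fun ⟨b, hb, hβ⟩ => ⟨b, ht.extends.actions hb, hβ⟩
    cases ht with
    | refine τ' b _ _ _ _ => exact hβ.elim key fun h' => .inr (.inr ⟨b, .inr rfl, h'⟩)
    | insert b _ _ _ => exact hβ.elim key fun h' => .inr (.inr ⟨b, .inr rfl, h'⟩)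
    | restrict _ hr =>
      obtain ⟨F, C, -, -, hF, rfl⟩ := hr
      exact hβ.elim key fun h' => .inr (.inl (hF β h'))

/-- The actions below an unrefined task of `φ` are new. -/
theorem Descends.fresh (h : Reachable P φ ψ) (hφ : φ.WellFormed P) {τ : PlanTask O T}
    (hτ : τ ∈ φ.tasks) {a : Action O SV T} (ha : ψ.Descends τ a) : φ.Fresh a.id := by
  induction ha with
  | base a ha => exact h.fresh_of_not_mem ha fun h' => hφ.not_mem_tasks _ _ h' hτ
  | step b a τ' _ hτ' ha ih =>
    -- If `τ'` were already refined in `φ`, it could not be a subtask of `b`, whose identifier is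
    -- fresh by induction.
    exact h.fresh_of_not_mem ha fun h' => hφ.not_mem_subtasks ih h' hτ'

/-- A descendant of a refined task of `φ` is a descendant in `φ` already, or it is found below an
unrefined task of `φ` that descends from this task. -/
theorem Descends.old_or_new (hφ : φ.WellFormed P) (hψ : ψ.WellFormed P) (hx : φ.Extends ψ)
    {τ : PlanTask O T} (hτ : ∃ c, (τ, c) ∈ φ.refinements) {a : Action O SV T}
    (ha : ψ.Descends τ a) :
    φ.Descends τ a ∨ ∃ τ' ∈ φ.tasks, φ.TaskDescends τ τ' ∧ ψ.Descends τ' a := by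
  induction ha with
  | base a ha =>
    obtain ⟨c, hc⟩ := hτ
    obtain rfl := hψ.action_unique _ _ _ ha (hx.refinements hc)
    exact .inl (.base a hc)
  | step b a τ' _ hτ' ha ih =>
    rcases ih with hb | ⟨τ₁, hτ₁, hd, hb⟩
    · rcases hφ.subtasks b (hb.mem_actions hφ) τ' hτ' with h | ⟨c, hc⟩
      · exact .inr ⟨τ', h, ⟨b, hb, hτ'⟩, .base a ha⟩
      · obtain rfl := hψ.action_unique _ _ _ ha (hx.refinements hc)
        exact .inl (.step b a τ' hb hτ' hc)
    · exact .inr ⟨τ₁, hτ₁, hd, .step b a τ' hb hτ' ha⟩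

/-- A new action is found below an unrefined task of `φ` or below an action inserted later. -/
theorem _root_.FAPE.Reachable.exists_ancestor (h : Reachable P φ ψ) :
    (∀ a ∈ ψ.actions, a ∈ φ.actions ∨ ∃ τ, ψ.Descends τ a ∧
      (τ ∈ φ.tasks ∨ ∃ b, τ = b.rootTask ∧ (τ, b) ∈ ψ.refinements ∧ b ∉ φ.actions)) ∧
    ∀ τ ∈ ψ.tasks, τ ∈ φ.tasks ∨ ∃ a ∈ ψ.actions, a ∉ φ.actions ∧ τ ∈ a.subtasks := by
  -- The statement on tasks supports the one on actions: when a task is refined, it must be known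
  -- whether it was there in `φ` or came with a new action.
  induction h with
  | refl => exact ⟨fun _ => .inl, fun _ => .inl⟩
  | @tail ψ χ h ht ih =>
    have hx := ht.extends
    have key : ∀ a ∈ ψ.actions, a ∈ φ.actions ∨ ∃ τ, χ.Descends τ a ∧
        (τ ∈ φ.tasks ∨ ∃ b, τ = b.rootTask ∧ (τ, b) ∈ χ.refinements ∧ b ∉ φ.actions) := by
      intro a ha
      rcases ih.1 a ha with h1 | ⟨τ, hd, h1⟩
      · exact .inl h1
      · refine .inr ⟨τ, hd.mono hx.refinements, h1.imp_right ?_⟩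
        rintro ⟨b, hb, hr, hb'⟩
        exact ⟨b, hb, hx.refinements hr, hb'⟩
    have key' : ∀ τ ∈ ψ.tasks,
        τ ∈ φ.tasks ∨ ∃ a ∈ χ.actions, a ∉ φ.actions ∧ τ ∈ a.subtasks := fun τ hτ =>
      (ih.2 τ hτ).imp_right fun ⟨a, ha, h1⟩ => ⟨a, hx.actions ha, h1⟩
    cases ht with
    | refine τ b hτ _ hk _ =>
      have hb : b ∉ φ.actions := fun hb => (hk.of_extends (Reachable.extends h)).1 b hb rfl
      constructor
      · rintro a (ha | rfl)
        · exact key a ha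
        · refine .inr ?_
          rcases ih.2 τ hτ with h1 | ⟨c, hc, hc', hs⟩
          · exact ⟨τ, .base a (.inr rfl), .inl h1⟩
          · rcases key c hc with h2 | ⟨τ', hd, h2⟩
            · exact (hc' h2).elim
            · exact ⟨τ', .step c a τ hd hs (.inr rfl), h2⟩
      · rintro τ' (hτ' | hτ')
        · exact key' τ' hτ'.1
        · exact .inr ⟨b, .inr rfl, hb, hτ'⟩
    | insert b _ hk _ =>
      have hb : b ∉ φ.actions := fun hb => (hk.of_extends (Reachable.extends h)).1 b hb rfl
      constructor
      · rintro a (ha | rfl)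
        · exact key a ha
        · exact .inr ⟨a.rootTask, .base a (.inr rfl), .inr ⟨a, rfl, .inr rfl, hb⟩⟩
      · rintro τ' (hτ' | hτ')
        · exact key' τ' hτ'
        · exact .inr ⟨b, .inr rfl, hb, hτ'⟩
    | restrict _ hr =>
      obtain ⟨F, C, -, -, -, rfl⟩ := hr
      exact ⟨key, key'⟩

/-- What is produced below a task is a possible effect of the action refining this task, with the
delay observed in the instantiation. -/
theorem Descends.possibleEffect (hφ : φ.WellFormed P) {σ : Assignment Name O}
    (hσ : σ ∈ φ.instances) {f : Fluent O SV} {τ : PlanTask O T} {b : Action O SV T}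
    (hb : φ.Descends τ b) {d : ℤ}
    (hd : PossibleEffect P f b.template (σ.comap b.rename) d) :
    ∃ a, (τ, a) ∈ φ.refinements ∧ PossibleEffect P f a.template (σ.comap a.rename)
      (b.task.start.eval σ - a.task.start.eval σ + d) := by
  induction hb generalizing d with
  | base b hb => exact ⟨b, hb, by simpa using hd⟩
  | step c b τ' hc hτ' hb ih =>
    have hcm := hc.mem_actions hφ
    obtain ⟨t, ht, rfl⟩ := hτ'
    rcases hφ.unify _ _ hb with h | ⟨hu, -⟩
    -- A subtask is not a root task, so the refinement of `τ'` did post its unification constraints.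
    · cases congrArg PlanTask.origin h
    have hargs := hσ.1 _ (hu (.inl rfl))
    have hstart := hσ.1 _ (hu (.inr (.inl rfl)))
    have := PossibleEffect.sub c.template b.template (σ.comap c.rename) (σ.comap b.rename) t d
      (Action.isInstance_comap hσ (hφ.action_assertions c hcm) (hφ.action_constraints c hcm))
      ht (hφ.mem_templates b (hφ.mem_actions _ _ hb)) (hφ.task_sym _ _ hb)
      (by rw [← ObjTerm.map_eval_map, ← ObjTerm.map_eval_map]; exact hargs) hd
    obtain ⟨a, ha, h⟩ := ih this
    refine ⟨a, ha, ?_⟩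
    -- The delays telescope: by unification, `b` starts when the subtask that it refines starts.
    convert h using 1
    have h1 : b.task.start.eval σ = t.start.eval (σ.comap c.rename) := hstart
    have h2 : c.task.start.eval σ = (σ.comap c.rename).time c.template.start := add_zero _
    rw [h1, h2]
    ring

/-- Support from below a task is a possible effect of the action refining this task. -/
theorem AddedUnder.possibleEffect (hφ : φ.WellFormed P) {σ : Assignment Name O}
    (hσ : σ ∈ φ.instances) {f : Fluent O SV} {τ : PlanTask O T} {β : Assertion Name O SV}
    (hβ : φ.AddedUnder τ β) (hf : β.Produces σ f) :
    ∃ a, (τ, a) ∈ φ.refinements ∧ PossibleEffect P f a.template (σ.comap a.rename)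
      (β.finish.eval σ - a.task.start.eval σ) := by
  obtain ⟨b, hb, ⟨γ, hγ, rfl⟩, hd⟩ := hβ
  obtain ⟨a, ha, h⟩ := hd.possibleEffect hφ hσ
    (PossibleEffect.direct b.template (σ.comap b.rename) γ
      (Action.isInstance_comap hσ (hφ.action_assertions b hb) (hφ.action_constraints b hb)) hγ
      ((γ.produces_map _ _ f).1 hf))
  refine ⟨a, ha, ?_⟩
  convert h using 1
  have h1 : (γ.map b.rename).finish.eval σ = γ.finish.eval (σ.comap b.rename) := by
    rw [Assertion.finish_map, TimeTerm.eval_map]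
  have h2 : b.task.start.eval σ = (σ.comap b.rename).time b.template.start := add_zero _
  rw [h1, h2]
  ring

/-! ## Restrictions of solution plans -/

/-- A restriction leaves fewer instantiations to check, and all assertions that maintain the fluent
are kept. -/
theorem Supports.restrict {β α : Assertion Name O SV} (h : φ.Supports β α)
    (F : Set (Assertion Name O SV)) (C : Set (Constraint Name O)) :
    (φ.restrict F C).Supports β α := by
  refine ⟨.inl h.1, fun σ hσ => ?_⟩
  obtain ⟨f, h1, h2, h3, h4⟩ := h.2 σ ((Extends.restrict φ F C).instances_subset hσ)
  refine ⟨f, h1, h2, h3, fun r hr hr' => ?_⟩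
  obtain ⟨γ, hγ, h5⟩ := h4 r hr hr'
  exact ⟨γ, .inl hγ, h5⟩

theorem CausallySupported.restrict {α : Assertion Name O SV} (h : φ.CausallySupported α)
    (F : Set (Assertion Name O SV)) (C : Set (Constraint Name O)) :
    (φ.restrict F C).CausallySupported α :=
  h.imp_right fun ⟨β, hβ⟩ => ⟨β, hβ.restrict F C⟩

theorem AddedUnder.mono {τ : PlanTask O T} {β : Assertion Name O SV} (h : φ.AddedUnder τ β)
    (hx : φ.Extends ψ) : ψ.AddedUnder τ β := by
  obtain ⟨b, hb, hβ, hd⟩ := h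
  exact ⟨b, hx.actions hb, hβ, hd.mono hx.refinements⟩

theorem restrict_empty (φ : Chronicle O SV T) : φ.restrict ∅ ∅ = φ :=
  ext rfl rfl rfl (Set.union_empty _) (Set.union_empty _)

theorem isRestriction_post (φ : Chronicle O SV T) (c : Constraint Name O) :
    φ.IsRestriction (φ.restrict ∅ {c}) :=
  ⟨∅, {c}, Set.finite_empty, Set.finite_singleton c, fun _ h => h.elim, rfl⟩

theorem isRestriction_link (φ : Chronicle O SV T) (β α : Assertion Name O SV) :
    φ.IsRestriction (φ.restrict (causalLink β α) (linkConstraints β α)) := by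
  refine ⟨_, _, ?_, ?_, ?_, rfl⟩
  · refine Set.Subsingleton.finite ?_
    rintro _ ⟨v, hv, rfl⟩ _ ⟨w, hw, rfl⟩
    cases hv.symm.trans hw
    rfl
  · refine (Set.toFinite _).union (Set.Subsingleton.finite ?_)
    rintro _ ⟨v, w, hv, hw, rfl⟩ _ ⟨v', w', hv', hw', rfl⟩
    cases hv.symm.trans hv'
    cases hw.symm.trans hw'
    rfl
  · rintro _ ⟨v, -, rfl⟩
    trivial

end Chronicle

/-! ### Adding constraints and causal links to a solution plan -/

section Explicitation

variable {O SV T : Type*} {P : Problem O SV T} {φ ψ χ : Chronicle O SV T}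

theorem IsExplicitation.refl {σ : Assignment Name O} (h : IsSolution P ψ)
    (hσ : σ ∈ ψ.instances) : IsExplicitation P σ ψ ψ :=
  ⟨⟨∅, ∅, Set.finite_empty, Set.finite_empty, fun _ h => h.elim, ψ.restrict_empty.symm⟩, h, hσ⟩

theorem IsExplicitation.trans {σ : Assignment Name O} (h : IsExplicitation P σ φ ψ)
    (h' : IsExplicitation P σ ψ χ) : IsExplicitation P σ φ χ := by
  obtain ⟨⟨F, C, hF, hC, hp, rfl⟩, -⟩ := h
  obtain ⟨⟨F', C', hF', hC', hp', rfl⟩, h2⟩ := h'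
  refine ⟨⟨F ∪ F', C ∪ C', hF.union hF', hC.union hC', ?_, Chronicle.restrict_restrict _ _ _ _ _⟩,
    h2⟩
  rintro α (hα | hα)
  exacts [hp α hα, hp' α hα]

/-- A constraint satisfied by an instantiation can be posted to a solution plan. -/
theorem IsSolution.post (h : IsSolution P ψ) {σ : Assignment Name O} (hσ : σ ∈ ψ.instances)
    {c : Constraint Name O} (hc : c.Sat σ) : IsExplicitation P σ ψ (ψ.restrict ∅ {c}) := by
  have hr := ψ.isRestriction_post c
  have hσ' : σ ∈ (ψ.restrict ∅ {c}).instances := by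
    refine ⟨?_, ?_⟩
    · rintro c' (hc' | rfl)
      exacts [hσ.1 c' hc', hc]
    · rintro α (hα | hα)
      exacts [hσ.2 α hα, hα.elim]
  refine ⟨hr, ⟨h.1.tail (.restrict _ _ hr), h.2.1, ?_, ⟨σ, hσ'⟩, ?_⟩, hσ'⟩
  · rintro α (hα | hα)
    exacts [(h.2.2.1 α hα).restrict _ _, hα.elim]
  · rintro τ hτ α (hα | hα) β (hβ | hβ)
    · exact h.2.2.2.2 τ ((Chronicle.Extends.restrict ψ _ _).instances_subset hτ) α hα β hβ
    exacts [hβ.elim, hα.elim, hα.elim]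

/-- The requirements of an assertion hold at different times. -/
theorem Assertion.requirement_unique {N : Type*} {σ : Assignment N O} {α : Assertion N O SV}
    (hα : α.WellTimed σ) {p q : Requirement N O SV} (hp : p ∈ α.requirements)
    (hq : q ∈ α.requirements) {r : ℝ} (hr : r ∈ p.extent σ) (hr' : r ∈ q.extent σ) : p = q := by
  cases α with
  | persistence s e sv v =>
    simp only [requirements, List.mem_singleton] at hp hq
    rw [hp, hq]
  | change s e sv v w =>
    -- Strictness separates the two endpoint persistences of a change; were `s` and `e` equal, both
    -- would hold at the same time.
    have hlt : (s.eval σ : ℝ) < e.eval σ := by exact_mod_cast hα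
    simp only [requirements, List.mem_cons, List.not_mem_nil, or_false] at hp hq
    rcases hp with rfl | rfl | rfl <;> rcases hq with rfl | rfl | rfl <;>
      simp [Requirement.extent] at hr hr' ⊢ <;> exfalso <;> grind
  | assign t sv v =>
    simp only [requirements, List.mem_cons, List.not_mem_nil, or_false] at hp hq
    rcases hp with rfl | rfl <;> rcases hq with rfl | rfl <;>
      simp [Requirement.extent] at hr hr' ⊢ <;> exfalso <;> grind

theorem linkConstraints_sat {σ : Assignment Name O} {β α : Assertion Name O SV} {f : Fluent O SV}
    (h1 : α.Needs σ f) (h2 : β.Produces σ f) (h3 : β.finish.eval σ ≤ α.start.eval σ) :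
    ∀ c ∈ linkConstraints β α, c.Sat σ := by
  obtain ⟨v, hv, rfl⟩ := h1
  obtain ⟨w, hw, he⟩ := h2
  have he1 := congrArg (fun f => f.1.2) he
  have he2 := congrArg Prod.snd he
  rintro c ((rfl | rfl) | ⟨v', w', hv', hw', rfl⟩)
  · exact h3
  · exact he1.symm
  · cases hv.symm.trans hv'
    cases hw.symm.trans hw'
    simpa [Constraint.Sat] using he2.symm

/-- The causal link from a causal supporter can be added to a solution plan. -/
theorem IsSolution.link (h : IsSolution P ψ) {σ : Assignment Name O} (hσ : σ ∈ ψ.instances)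
    {β α : Assertion Name O SV} (hβ : ψ.Supports β α) :
    IsExplicitation P σ ψ (ψ.restrict (causalLink β α) (linkConstraints β α)) := by
  set χ := ψ.restrict (causalLink β α) (linkConstraints β α) with hχ
  have hx : ψ.Extends χ := .restrict ψ _ _
  have hr : ψ.IsRestriction χ := ψ.isRestriction_link β α
  have hσ' : σ ∈ χ.instances := by
    obtain ⟨f, h1, h2, h3, -⟩ := hβ.2 σ hσ
    refine ⟨?_, ?_⟩
    · rintro c (hc | hc)
      exacts [hσ.1 c hc, linkConstraints_sat h1 h2 h3 c hc]
    · rintro γ (hγ | ⟨v, -, rfl⟩)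
      exacts [hσ.2 γ hγ, h3]
  -- A link agrees with every assertion `δ` that it meets. At a common time `r`, causal support
  -- provides some `ε` of `ψ` that requires the fluent of the link, and `ε` does not conflict with
  -- `δ`.
  have key : ∀ τ ∈ ψ.instances, ∀ γ ∈ causalLink β α, ∀ δ ∈ ψ.assertions,
      ∀ p ∈ γ.requirements, ∀ q ∈ δ.requirements,
        p.stateVar.eval τ = q.stateVar.eval τ → (p.extent τ ∩ q.extent τ).Nonempty →
        ∃ v w, p.value = some v ∧ q.value = some w ∧ v.eval τ = w.eval τ := by
    rintro τ hτ _ ⟨v, hv, rfl⟩ δ hδ p hp q hq hsv ⟨r, hrp, hrq⟩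
    obtain rfl := List.mem_singleton.1 hp
    obtain ⟨f, ⟨v', hv', rfl⟩, -, -, h4⟩ := hβ.2 τ hτ
    cases hv.symm.trans hv'
    have hrp' : (β.finish.eval τ : ℝ) ≤ r ∧ r ≤ (α.start.eval τ : ℝ) := by
      simpa [Requirement.extent] using hrp
    obtain ⟨ε, hε, p', hp', hrp'', w, hw, hf⟩ := h4 r hrp'.1 hrp'.2
    have hf1 := congrArg Prod.fst hf
    have hf2 : v.eval τ = w.eval τ := congrArg Prod.snd hf
    -- Conflicts are defined between distinct assertions only. If `ε` is `δ` itself, its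
    -- requirements at time `r` coincide.
    by_cases he : ε = δ
    · subst he
      obtain rfl := Assertion.requirement_unique (hτ.2 ε hε) hp' hq hrp'' hrq
      exact ⟨v, w, rfl, hw, hf2⟩
    · by_contra hne
      refine h.2.2.2.2 τ hτ ε hε δ hδ he p' hp' q hq ⟨hf1.symm.trans hsv, ⟨r, hrp'', hrq⟩, ?_⟩
      rintro ⟨w₁, w₂, hw₁, hw₂, hw₃⟩
      cases hw.symm.trans hw₁
      exact hne ⟨v, w₂, rfl, hw₂, hf2.trans hw₃⟩
  refine ⟨hr, ⟨h.1.tail (.restrict _ _ hr), h.2.1, ?_, ⟨σ, hσ'⟩, ?_⟩, hσ'⟩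
  · rintro γ (hγ | ⟨v, hv, rfl⟩)
    · exact (h.2.2.1 γ hγ).restrict _ _
    -- The link is supported by `β` as well: it starts when `β` ends, and at this single time the
    -- link itself requires the fluent.
    · refine .inr ⟨β, .inl hβ.1, fun τ hτ => ?_⟩
      obtain ⟨f, ⟨v', hv', rfl⟩, h2, h3, -⟩ := hβ.2 τ (hx.instances_subset hτ)
      cases hv.symm.trans hv'
      refine ⟨_, ⟨v, rfl, rfl⟩, h2, le_rfl, fun r hr1 hr2 => ?_⟩
      have h3' : (β.finish.eval τ : ℝ) ≤ α.start.eval τ := by exact_mod_cast h3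
      exact ⟨_, .inr ⟨v, hv, rfl⟩, _, List.mem_singleton.2 rfl,
        .inr ⟨not_false, hr1, le_trans hr2 h3'⟩, v, rfl, rfl⟩
  · rintro τ hτ γ (hγ | hγ) δ (hδ | hδ) hne p hp q hq ⟨h1, h2, h3⟩
    · exact h.2.2.2.2 τ (hx.instances_subset hτ) γ hγ δ hδ hne p hp q hq ⟨h1, h2, h3⟩
    · obtain ⟨v, w, hv, hw, he⟩ := key τ (hx.instances_subset hτ) δ hδ γ hγ q hq p hp h1.symm
        (Set.inter_comm _ _ ▸ h2)
      exact h3 ⟨w, v, hw, hv, he.symm⟩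
    · exact h3 (key τ (hx.instances_subset hτ) γ hγ δ hδ p hp q hq h1 h2)
    -- Two assertions of `causalLink β α` are equal, since `α` needs only one value.
    · obtain ⟨v, hv, rfl⟩ := hγ
      obtain ⟨w, hw, rfl⟩ := hδ
      cases hv.symm.trans hw
      exact hne rfl

end Explicitation
end FAPE

namespace FAPE

/-! ## Separation constraints -/

section Separation

variable {N O SV : Type*}

theorem Assertion.requirement_names {α : Assertion N O SV} {p : Requirement N O SV}
    (hp : p ∈ α.requirements) : p.stateVar = α.stateVar ∧ p.lo.var ∈ α.names ∧
      p.hi.var ∈ α.names ∧ ∀ v, p.value = some v → v.names ⊆ α.names := by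
  cases α with
  | persistence s e sv v =>
    simp only [requirements, List.mem_singleton] at hp
    subst hp
    refine ⟨rfl, by simp [names], by simp [names], ?_⟩
    rintro _ ⟨⟩ n hn
    exact .inr hn
  | change s e sv v w =>
    simp only [requirements, List.mem_cons, List.not_mem_nil, or_false] at hp
    rcases hp with rfl | rfl | rfl <;>
      refine ⟨rfl, by simp [names], by simp [names], ?_⟩ <;> rintro _ ⟨⟩ n hn
    · exact .inl (.inr hn)
    · exact .inr hn
  | assign t sv v =>
    simp only [requirements, List.mem_cons, List.not_mem_nil, or_false] at hp
    rcases hp with rfl | rfl <;>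
      refine ⟨rfl, by simp [names], by simp [names], ?_⟩ <;> rintro _ ⟨⟩ n hn
    exact .inr hn

/-- Separation constraints compare only opposite endpoints; overlap can be inferred from their
failure because neither interval is empty. -/
theorem Assertion.requirement_nonempty {σ : Assignment N O} {α : Assertion N O SV}
    (hα : α.WellTimed σ) {p : Requirement N O SV} (hp : p ∈ α.requirements) :
    p.lo.eval σ ≤ p.hi.eval σ ∧ (p.isOpen → p.lo.eval σ < p.hi.eval σ) := by
  cases α with
  | persistence s e sv v =>
    simp only [requirements, List.mem_singleton] at hp
    subst hp
    exact ⟨hα, False.elim⟩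
  | change s e sv v w =>
    simp only [requirements, List.mem_cons, List.not_mem_nil, or_false] at hp
    rcases hp with rfl | rfl | rfl
    exacts [⟨le_rfl, False.elim⟩, ⟨le_of_lt hα, fun _ => hα⟩, ⟨le_rfl, False.elim⟩]
  | assign t sv v =>
    have hlt : (⟨t.var, t.offset - 1⟩ : TimeTerm N).eval σ < t.eval σ := by
      simp [TimeTerm.eval]
    simp only [requirements, List.mem_cons, List.not_mem_nil, or_false] at hp
    rcases hp with rfl | rfl
    exacts [⟨le_of_lt hlt, fun _ => hlt⟩, ⟨le_rfl, False.elim⟩]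

theorem _root_.List.map_eq_map_iff_zip {X Y : Type*} (e : X → Y) {xs ys : List X} :
    xs.map e = ys.map e ↔
      xs.length = ys.length ∧ ∀ xy ∈ xs.zip ys, e xy.1 = e xy.2 := by
  induction xs generalizing ys with
  | nil => cases ys <;> simp
  | cons x xs ih => cases ys with
    | nil => simp
    | cons y ys => simp [ih]; tauto

/-- The hypotheses are the negations of the temporal separations, strict as soon as one interval is
open. Density of the reals is essential for open intervals: those of an assignment contain no
integer. -/
theorem Requirement.extent_inter_nonempty {σ : Assignment N O} {p q : Requirement N O SV}
    (hp : p.lo.eval σ ≤ p.hi.eval σ ∧ (p.isOpen → p.lo.eval σ < p.hi.eval σ))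
    (hq : q.lo.eval σ ≤ q.hi.eval σ ∧ (q.isOpen → q.lo.eval σ < q.hi.eval σ))
    (h1 : ¬ p.isOpen → ¬ q.isOpen →
      q.lo.eval σ ≤ p.hi.eval σ ∧ p.lo.eval σ ≤ q.hi.eval σ)
    (h2 : p.isOpen ∨ q.isOpen → q.lo.eval σ < p.hi.eval σ ∧ p.lo.eval σ < q.hi.eval σ) :
    (p.extent σ ∩ q.extent σ).Nonempty := by
  have key : ∀ a b c d : ℝ, a < b → c ≤ d → c < b → a < d →
      ∃ r, a < r ∧ r < b ∧ c ≤ r ∧ r ≤ d ∧ (c < d → c < r ∧ r < d) := by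
    intro a b c d h1 h2 h3 h4
    -- Either there is room for a point strictly inside both intervals, or the closed interval is a
    -- single point lying in the open one.
    have hlt : max a c < min b d ∨ c = d := by
      rcases h2.lt_or_eq with h | h
      · exact .inl (max_lt (lt_min h1 h4) (lt_min h3 h))
      · exact .inr h
    rcases hlt with hlt | rfl
    · obtain ⟨r, hr, hr'⟩ := exists_between hlt
      obtain ⟨h5, h6⟩ := max_lt_iff.1 hr
      obtain ⟨h7, h8⟩ := lt_min_iff.1 hr'
      exact ⟨r, h5, h7, h6.le, h8.le, fun _ => ⟨h6, h8⟩⟩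
    · exact ⟨c, h4, h3, le_rfl, le_rfl, fun h => (lt_irrefl _ h).elim⟩
  have hp1 : (p.lo.eval σ : ℝ) ≤ p.hi.eval σ := by exact_mod_cast hp.1
  have hq1 : (q.lo.eval σ : ℝ) ≤ q.hi.eval σ := by exact_mod_cast hq.1
  by_cases hpo : p.isOpen
  · obtain ⟨h3, h4⟩ := h2 (.inl hpo)
    have h5 := hp.2 hpo
    obtain ⟨r, r1, r2, r3, r4, r5⟩ := key (p.lo.eval σ) (p.hi.eval σ) (q.lo.eval σ) (q.hi.eval σ)
      (by exact_mod_cast h5) hq1 (by exact_mod_cast h3) (by exact_mod_cast h4)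
    refine ⟨r, .inl ⟨hpo, r1, r2⟩, ?_⟩
    by_cases hqo : q.isOpen
    · have h6 := hq.2 hqo
      exact .inl ⟨hqo, r5 (by exact_mod_cast h6)⟩
    · exact .inr ⟨hqo, r3, r4⟩
  · by_cases hqo : q.isOpen
    · obtain ⟨h3, h4⟩ := h2 (.inr hqo)
      have h5 := hq.2 hqo
      obtain ⟨r, r1, r2, r3, r4, -⟩ := key (q.lo.eval σ) (q.hi.eval σ) (p.lo.eval σ)
        (p.hi.eval σ) (by exact_mod_cast h5) hp1 (by exact_mod_cast h4) (by exact_mod_cast h3)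
      exact ⟨r, .inr ⟨hpo, r3, r4⟩, .inl ⟨hqo, r1, r2⟩⟩
    · obtain ⟨h3, h4⟩ := h1 hpo hqo
      have h3' : (q.lo.eval σ : ℝ) ≤ p.hi.eval σ := by exact_mod_cast h3
      have h4' : (p.lo.eval σ : ℝ) ≤ q.hi.eval σ := by exact_mod_cast h4
      -- Two closed intervals share the later of their starts.
      exact ⟨max (p.lo.eval σ) (q.lo.eval σ), .inr ⟨hpo, le_max_left _ _, max_le hp1 h3'⟩,
        .inr ⟨hqo, le_max_right _ _, max_le h4' hq1⟩⟩

/-- Two requirements without conflict satisfy a separation constraint. -/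
theorem Requirement.exists_separation {σ σ' : Assignment N O} {α β : Assertion N O SV}
    (hα : α.WellTimed σ) (hβ : β.WellTimed σ) {p q : Requirement N O SV}
    (hp : p ∈ α.requirements) (hq : q ∈ β.requirements) (h' : p.Conflict σ' q)
    (h : ¬ p.Conflict σ q) : ∃ c ∈ p.separations q, c.Sat σ := by
  -- If no separation holds under `σ`, the three clauses of a conflict follow one by one: arguments,
  -- times, values.
  by_contra hno
  push Not at hno
  refine h ⟨?_, ?_, ?_⟩
  -- The symbol and the number of arguments do not depend on the instantiation, so the conflict
  -- under `σ'` fixes them; only the arguments depend on `σ`.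
  · have hsym : p.stateVar.sym = q.stateVar.sym := congrArg Prod.fst h'.1
    have hlen := ((List.map_eq_map_iff_zip _).1 (congrArg Prod.snd h'.1)).1
    refine Prod.ext hsym ((List.map_eq_map_iff_zip _).2 ⟨hlen, fun xy hxy => ?_⟩)
    by_contra hne
    exact hno (.objNe xy.1 xy.2) (.inl (.inl (.inl ⟨xy, hxy, rfl⟩))) hne
  · refine extent_inter_nonempty (Assertion.requirement_nonempty hα hp)
      (Assertion.requirement_nonempty hβ hq) (fun hpo hqo => ⟨?_, ?_⟩) fun ho => ⟨?_, ?_⟩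
    · exact not_lt.1 (hno (.timeLt p.hi q.lo) (.inl (.inl (.inr ⟨hpo, hqo, .inl rfl⟩))))
    · exact not_lt.1 (hno (.timeLt q.hi p.lo) (.inl (.inl (.inr ⟨hpo, hqo, .inr rfl⟩))))
    · exact not_le.1 (hno (.timeLe p.hi q.lo) (.inl (.inr ⟨ho, .inl rfl⟩)))
    · exact not_le.1 (hno (.timeLe q.hi p.lo) (.inl (.inr ⟨ho, .inr rfl⟩)))
  · rintro ⟨v, w, hv, hw, he⟩
    exact hno (.objEq [v] [w]) (.inr ⟨v, w, hv, hw, rfl⟩) (by simp [Constraint.Sat, he])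

/-- A separation constraint removes the conflict. -/
theorem Requirement.not_conflict_of_separation {σ : Assignment N O} {p q : Requirement N O SV}
    {c : Constraint N O} (hc : c ∈ p.separations q) (hs : c.Sat σ) : ¬ p.Conflict σ q := by
  rintro ⟨h1, ⟨r, hr, hr'⟩, h3⟩
  have hp : (p.lo.eval σ : ℝ) ≤ r ∧ r ≤ p.hi.eval σ ∧ (p.isOpen → p.lo.eval σ < r ∧
      r < p.hi.eval σ) := by
    rcases hr with ⟨ho, h4, h5⟩ | ⟨ho, h4, h5⟩
    exacts [⟨h4.le, h5.le, fun _ => ⟨h4, h5⟩⟩, ⟨h4, h5, fun h => (ho h).elim⟩]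
  have hq : (q.lo.eval σ : ℝ) ≤ r ∧ r ≤ q.hi.eval σ ∧ (q.isOpen → q.lo.eval σ < r ∧
      r < q.hi.eval σ) := by
    rcases hr' with ⟨ho, h4, h5⟩ | ⟨ho, h4, h5⟩
    exacts [⟨h4.le, h5.le, fun _ => ⟨h4, h5⟩⟩, ⟨h4, h5, fun h => (ho h).elim⟩]
  rcases hc with ((⟨xy, hxy, rfl⟩ | ⟨-, -, rfl | rfl⟩) | ⟨ho, rfl | rfl⟩) | ⟨v, w, hv, hw, rfl⟩
  · exact hs (((List.map_eq_map_iff_zip _).1 (congrArg Prod.snd h1)).2 xy hxy)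
  · have h4 : (p.hi.eval σ : ℝ) < q.lo.eval σ := by exact_mod_cast hs
    linarith
  · have h4 : (q.hi.eval σ : ℝ) < p.lo.eval σ := by exact_mod_cast hs
    linarith
  · have h4 : (p.hi.eval σ : ℝ) ≤ q.lo.eval σ := by exact_mod_cast hs
    rcases ho with ho | ho
    · linarith [hp.2.2 ho]
    · linarith [hq.2.2 ho]
  · have h4 : (q.hi.eval σ : ℝ) ≤ p.lo.eval σ := by exact_mod_cast hs
    rcases ho with ho | ho
    · linarith [hp.2.2 ho]
    · linarith [hq.2.2 ho]
  · exact h3 ⟨v, w, hv, hw, by simpa [Constraint.Sat] using hs⟩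

end Separation

/-! ### Variables of separation constraints and of causal links -/

namespace Chronicle

variable {O SV T : Type*} {φ : Chronicle O SV T}

theorem covers_separation {α β : Assertion Name O SV} (hα : α ∈ φ.assertions)
    (hβ : β ∈ φ.assertions) {p q : Requirement Name O SV} (hp : p ∈ α.requirements)
    (hq : q ∈ β.requirements) {c : Constraint Name O} (hc : c ∈ p.separations q) :
    φ.Covers ∅ {c} := by
  refine ⟨fun _ h => h.elim, ?_⟩
  rintro _ rfl n hn
  suffices h : n ∈ α.names ∨ n ∈ β.names from
    h.elim (fun h => ⟨α, hα, h⟩) fun h => ⟨β, hβ, h⟩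
  obtain ⟨p1, p2, p3, p4⟩ := Assertion.requirement_names hp
  obtain ⟨q1, q2, q3, q4⟩ := Assertion.requirement_names hq
  rcases hc with ((⟨xy, hxy, rfl⟩ | ⟨-, -, rfl | rfl⟩) | ⟨-, rfl | rfl⟩) | ⟨v, w, hv, hw, rfl⟩
  · obtain ⟨h1, h2⟩ := List.of_mem_zip hxy
    rcases hn with hn | hn
    · exact .inl (α.stateVar_names_subset (p1 ▸ ⟨_, h1, hn⟩))
    · exact .inr (β.stateVar_names_subset (q1 ▸ ⟨_, h2, hn⟩))
  · rcases hn with rfl | rfl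
    exacts [.inl p3, .inr q2]
  · rcases hn with rfl | rfl
    exacts [.inr q3, .inl p2]
  · rcases hn with rfl | rfl
    exacts [.inl p3, .inr q2]
  · rcases hn with rfl | rfl
    exacts [.inr q3, .inl p2]
  · obtain ⟨x, hx, hn⟩ := hn
    rcases List.mem_append.1 hx with hx | hx <;> obtain rfl := List.mem_singleton.1 hx
    exacts [.inl (p4 _ hv hn), .inr (q4 _ hw hn)]

theorem covers_link {β α : Assertion Name O SV} (hβ : β ∈ φ.assertions)
    (hα : α ∈ φ.assertions) : φ.Covers (causalLink β α) (linkConstraints β α) := by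
  have key : ∀ n, n ∈ α.names ∨ n ∈ β.names → ∃ γ ∈ φ.assertions, n ∈ γ.names := fun n h =>
    h.elim (fun h => ⟨α, hα, h⟩) fun h => ⟨β, hβ, h⟩
  refine ⟨?_, ?_⟩
  · rintro _ ⟨v, hv, rfl⟩ n hn
    refine key n ?_
    rcases hn with ((rfl | rfl) | hn) | hn
    · exact .inr β.finish_mem_names
    · exact .inl α.start_mem_names
    · exact .inl (α.stateVar_names_subset hn)
    · exact .inl (Assertion.needs_names_subset hv hn)
  · rintro _ ((rfl | rfl) | ⟨v, w, hv, hw, rfl⟩) n hn <;> refine key n ?_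
    · rcases hn with rfl | rfl
      exacts [.inr β.finish_mem_names, .inl α.start_mem_names]
    · obtain ⟨x, hx, hn⟩ := hn
      rcases List.mem_append.1 hx with hx | hx
      · exact .inr (β.stateVar_names_subset ⟨x, hx, hn⟩)
      · exact .inl (α.stateVar_names_subset ⟨x, hx, hn⟩)
    · obtain ⟨x, hx, hn⟩ := hn
      rcases List.mem_append.1 hx with hx | hx <;> obtain rfl := List.mem_singleton.1 hx
      · exact .inr (Assertion.produces_names_subset hw hn)
      · exact .inl (Assertion.needs_names_subset hv hn)

end Chronicle

/-! ## The search space -/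

namespace SearchState

variable {O SV T : Type*} {P : Problem O SV T} {s : SearchState O SV T} {ψ : Chronicle O SV T}

/-- The invariants of the search space. -/
structure WellFormed (P : Problem O SV T) (s : SearchState O SV T) : Prop where
  reachable : Reachable P (Chronicle.initial P) s.chronicle
  mem_link : ∀ β α, (β, α) ∈ s.links → β ∈ s.chronicle.assertions
  link_assertions : ∀ β α, (β, α) ∈ s.links → causalLink β α ⊆ s.chronicle.assertions
  link_constraints : ∀ β α, (β, α) ∈ s.links → linkConstraints β α ⊆ s.chronicle.constraints
  link_fluent : ∀ β α, (β, α) ∈ s.links →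
    β.stateVar.sym = α.stateVar.sym ∧ (∃ v, α.needs = some v) ∧ ∃ w, β.produces = some w
  commitments : ∀ α, ∀ τ ∈ s.commitments α,
    τ ∈ s.chronicle.tasks ∨ ∃ a, (τ, a) ∈ s.chronicle.refinements

theorem WellFormed.chronicle (h : s.WellFormed P) : s.chronicle.WellFormed P :=
  (Chronicle.wellFormed_initial P).of_reachable h.reachable

theorem commitments_of_extends {φ ψ : Chronicle O SV T} (hx : φ.Extends ψ) {τ : PlanTask O T}
    (h : τ ∈ φ.tasks ∨ ∃ a, (τ, a) ∈ φ.refinements) :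
    τ ∈ ψ.tasks ∨ ∃ a, (τ, a) ∈ ψ.refinements := by
  rcases h with h | ⟨a, ha⟩
  · exact (hx.tasks τ h).imp_right And.left
  · exact .inr ⟨a, hx.refinements ha⟩

theorem WellFormed.of_chronicle (h : s.WellFormed P) {φ : Chronicle O SV T}
    (hr : Reachable P s.chronicle φ) :
    ({ s with chronicle := φ } : SearchState O SV T).WellFormed P where
  reachable := h.reachable.trans hr
  mem_link β α hl := hr.extends.assertions (h.mem_link β α hl)
  link_assertions β α hl := (h.link_assertions β α hl).trans hr.extends.assertions
  link_constraints β α hl := (h.link_constraints β α hl).trans hr.extends.constraints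
  link_fluent := h.link_fluent
  commitments α τ hτ := commitments_of_extends hr.extends (h.commitments α τ hτ)

theorem WellFormed.commit (h : s.WellFormed P) (α : Assertion Name O SV) {τ : PlanTask O T}
    (hτ : τ ∈ s.chronicle.tasks ∨ ∃ a, (τ, a) ∈ s.chronicle.refinements) :
    ({ s with commitments := s.commit α τ } : SearchState O SV T).WellFormed P where
  reachable := h.reachable
  mem_link := h.mem_link
  link_assertions := h.link_assertions
  link_constraints := h.link_constraints
  link_fluent := h.link_fluent
  commitments := by
    rintro α' τ' (hτ' | ⟨-, rfl⟩)
    exacts [h.commitments α' τ' hτ', hτ]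

theorem WellFormed.transform (h : s.WellFormed P) {x : Flaw O SV T} (hx : s.IsFlaw x)
    {ρ : Resolver O SV T} (hρ : s.IsResolver P x ρ) : (s.transform ρ).WellFormed P := by
  cases x with
  | unrefined τ =>
    cases ρ with
    | refine τ' a =>
      obtain ⟨rfl, ha, hk, hsym, -⟩ := hρ
      exact h.of_chronicle (.single (.refine _ _ a hx ha hk hsym))
    | _ => exact hρ.elim
  | unsupported α =>
    cases ρ with
    | link β α' =>
      obtain ⟨rfl, hβ, ⟨σ, hσ, f, ⟨v, hv, hf⟩, w, hw, hf'⟩, -⟩ := hρ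
      have hr : Reachable P s.chronicle
          (s.chronicle.restrict (causalLink β α') (linkConstraints β α')) :=
        .single (.restrict _ _ (s.chronicle.isRestriction_link β α'))
      have h' := h.of_chronicle hr
      refine ⟨h'.reachable, ?_, ?_, ?_, ?_, h'.commitments⟩
      · rintro β' α' (hl | hl)
        · exact h'.mem_link _ _ hl
        · cases hl; exact .inl hβ
      · rintro β' α' (hl | hl)
        · exact h'.link_assertions _ _ hl
        · cases hl; exact Set.subset_union_right
      · rintro β' α' (hl | hl)
        · exact h'.link_constraints _ _ hl
        · cases hl; exact Set.subset_union_right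
      · rintro β' α' (hl | hl)
        · exact h'.link_fluent _ _ hl
        · cases hl
          refine ⟨?_, ⟨v, hv⟩, w, hw⟩
          -- The symbols are independent of the instantiation, so the one that justified the
          -- resolver is enough.
          exact congrArg (fun f => f.1.1) (hf'.symm.trans hf)
    | supportFromTask α' τ =>
      obtain ⟨rfl, hτ, -⟩ := hρ
      exact h.commit _ (.inl hτ)
    | supportFromAction α' a =>
      obtain ⟨rfl, -, ha, hf, hk, -⟩ := hρ
      exact (h.of_chronicle (.single (.insert _ a ha hk hf))).commit _ (.inr ⟨a, .inr rfl⟩)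
    | _ => exact hρ.elim
  | conflict α β p q =>
    cases ρ with
    | post c =>
      exact h.of_chronicle (.single (.restrict _ _ (s.chronicle.isRestriction_post c)))
    | _ => exact hρ.elim

theorem _root_.FAPE.InSearchSpace.wellFormed (h : InSearchSpace P s) : s.WellFormed P := by
  induction h with
  | initial => exact ⟨.refl, fun _ _ h => h.elim, fun _ _ h => h.elim, fun _ _ h => h.elim,
      fun _ _ h => h.elim, fun _ _ h => h.elim⟩
  | step s x ρ _ hx hρ ih => exact ih.transform hx.1 hρ

/-! ## Soundness -/

/-- The link constraints unify arguments and values only. Equality of the symbols comes from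
`link_fluent`, established when the link was chosen. -/
theorem WellFormed.produces_of_link (h : s.WellFormed P) {β α : Assertion Name O SV}
    (hl : (β, α) ∈ s.links) {σ : Assignment Name O} (hσ : σ ∈ s.chronicle.instances)
    {v : ObjTerm Name O} (hv : α.needs = some v) :
    β.Produces σ (α.stateVar.eval σ, v.eval σ) ∧ β.finish.eval σ ≤ α.start.eval σ := by
  obtain ⟨hsym, -, w, hw⟩ := h.link_fluent β α hl
  have hc := h.link_constraints β α hl
  have h1 : β.finish.eval σ ≤ α.start.eval σ := hσ.1 _ (hc (.inl (.inl rfl)))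
  have h2 : β.stateVar.args.map (ObjTerm.eval σ) = α.stateVar.args.map (ObjTerm.eval σ) :=
    hσ.1 _ (hc (.inl (.inr rfl)))
  have h3 : [w].map (ObjTerm.eval σ) = [v].map (ObjTerm.eval σ) :=
    hσ.1 _ (hc (.inr ⟨v, w, hv, hw, rfl⟩))
  refine ⟨⟨w, hw, ?_⟩, h1⟩
  refine Prod.ext (Prod.ext hsym.symm h2.symm) ?_
  simpa using h3.symm

/-- The persistence of the link is itself the assertion that maintains the fluent up to the start of
`α`. -/
theorem WellFormed.supports_of_link (h : s.WellFormed P) {β α : Assertion Name O SV}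
    (hl : (β, α) ∈ s.links) : s.chronicle.Supports β α := by
  refine ⟨h.mem_link β α hl, fun σ hσ => ?_⟩
  obtain ⟨-, ⟨v, hv⟩, -⟩ := h.link_fluent β α hl
  obtain ⟨h1, h2⟩ := h.produces_of_link hl hσ hv
  refine ⟨_, ⟨v, hv, rfl⟩, h1, h2, fun r hr hr' => ?_⟩
  exact ⟨_, h.link_assertions β α hl ⟨v, hv, rfl⟩, _, List.mem_singleton.2 rfl,
    .inr ⟨not_false, hr, hr'⟩, v, rfl, rfl⟩

theorem WellFormed.supports_causalLink (h : s.WellFormed P) {β α γ : Assertion Name O SV}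
    (hl : (β, α) ∈ s.links) (hγ : γ ∈ causalLink β α) : s.chronicle.Supports β γ := by
  refine ⟨h.mem_link β α hl, fun σ hσ => ?_⟩
  have hγ' := h.link_assertions β α hl hγ
  obtain ⟨v, hv, rfl⟩ := hγ
  obtain ⟨h1, h2⟩ := h.produces_of_link hl hσ hv
  have h2' : (β.finish.eval σ : ℝ) ≤ α.start.eval σ := by exact_mod_cast h2
  refine ⟨_, ⟨v, rfl, rfl⟩, h1, le_rfl, fun r hr hr' => ?_⟩
  exact ⟨_, hγ', _, List.mem_singleton.2 rfl, .inr ⟨not_false, hr, hr'.trans h2'⟩, v, rfl, rfl⟩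

/-- The chronicle of a flawless state is a solution plan. -/
theorem WellFormed.isSolution (h : s.WellFormed P) (hs : ∀ x, ¬ s.IsFlaw x)
    (hne : s.chronicle.instances.Nonempty) : IsSolution P s.chronicle := by
  refine ⟨h.reachable, Set.eq_empty_iff_forall_notMem.2 fun τ => hs (.unrefined τ), ?_, hne, ?_⟩
  · intro α hα
    by_contra hno
    refine hs (.unsupported α) ⟨hα, fun ha => hno (.inl ha), ?_, ?_⟩
    · rintro ⟨β, γ⟩ hl hγ
      exact hno (.inr ⟨β, h.supports_causalLink hl hγ⟩)
    · exact fun β hl => hno (.inr ⟨β, h.supports_of_link hl⟩)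
  · exact fun σ hσ α hα β hβ hne p hp q hq hc =>
      hs (.conflict α β p q) ⟨hα, hβ, hne, hp, hq, σ, hσ, hc⟩

theorem _root_.FAPE.Fape.isSolution {select : SearchState O SV T → Flaw O SV T}
    (hsel : IsStrategy select) {φ : Chronicle O SV T} (h : Fape P select s φ)
    (hs : s.WellFormed P) : IsSolution P φ := by
  induction h with
  | done s h hc => exact hs.isSolution h hc
  | step s ρ φ h hρ _ ih => exact ih (hs.transform (hsel s h).1 hρ)

end SearchState
end FAPE

namespace FAPE

/-! ## Progress towards a completion -/

namespace SearchState

variable {O SV T : Type*} {P : Problem O SV T} {s : SearchState O SV T} {ψ : Chronicle O SV T}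
  {σ : Assignment Name O}

/-- The actions of `ψ` that have not been added yet. -/
def newActions (s : SearchState O SV T) (ψ : Chronicle O SV T) : Set (Action O SV T) :=
  ψ.actions \ s.chronicle.actions

/-- The assertions of `ψ` that are not causal links and have no incoming causal link yet. -/
def openAssertions (s : SearchState O SV T) (ψ : Chronicle O SV T) : Set (Assertion Name O SV) :=
  {α | α ∈ ψ.assertions ∧ (∀ l ∈ s.links, α ∉ causalLink l.1 l.2) ∧ ∀ β, (β, α) ∉ s.links}

/-- The commitments that have not been made yet. -/
def openCommitments (s : SearchState O SV T) (ψ : Chronicle O SV T) :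
    Set (Assertion Name O SV × PlanTask O T) :=
  {x | x.1 ∈ ψ.assertions ∧ x.2 ∈ Prod.fst '' ψ.refinements ∧ x.2 ∉ s.commitments x.1}

/-- The conflicts that are possible in the chronicle of `s` between the assertions of `ψ`. -/
def threats (s : SearchState O SV T) (ψ : Chronicle O SV T) :
    Set ((Assertion Name O SV × Assertion Name O SV) ×
      (Requirement Name O SV × Requirement Name O SV)) :=
  {x | (x.1.1 ∈ ψ.assertions ∧ x.1.2 ∈ ψ.assertions) ∧
    (x.2.1 ∈ x.1.1.requirements ∧ x.2.2 ∈ x.1.2.requirements) ∧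
    ∃ σ ∈ s.chronicle.instances, x.2.1.Conflict σ x.2.2}

/-- What remains to be done in order to reach `ψ` from `s`, ordered lexicographically. -/
noncomputable def rank (s : SearchState O SV T) (ψ : Chronicle O SV T) : ℕ ×ₗ ℕ ×ₗ ℕ ×ₗ ℕ :=
  toLex ((s.newActions ψ).ncard, toLex ((s.openAssertions ψ).ncard,
    toLex ((s.openCommitments ψ).ncard, (s.threats ψ).ncard)))

theorem finite_threats (s : SearchState O SV T) (hψ : ψ.assertions.Finite) :
    (s.threats ψ).Finite := by
  have hR : (⋃ α ∈ ψ.assertions, {p | p ∈ α.requirements}).Finite :=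
    hψ.biUnion fun α _ => α.requirements.finite_toSet
  refine ((hψ.prod hψ).prod (hR.prod hR)).subset ?_
  rintro ⟨⟨α, β⟩, p, q⟩ ⟨h1, h2, -⟩
  exact ⟨h1, Set.mem_biUnion h1.1 h2.1, Set.mem_biUnion h1.2 h2.2⟩

/-- The resolver `ρ` leads from `s` towards a solution plan `ψ'` that makes `ψ` explicit. -/
structure LeadsTo (P : Problem O SV T) (s : SearchState O SV T) (ψ : Chronicle O SV T)
    (σ : Assignment Name O) (x : Flaw O SV T) (ρ : Resolver O SV T) (ψ' : Chronicle O SV T) :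
    Prop where
  isResolver : s.IsResolver P x ρ
  isExplicitation : IsExplicitation P σ ψ ψ'
  isCompletion : (s.transform ρ).IsCompletion P ψ'
  rank_lt : (s.transform ρ).rank ψ' < s.rank ψ

/-- The number of missing actions is the leading component, so the effect of a new action on the
others is irrelevant. -/
theorem rank_lt_of_actions {s s' : SearchState O SV T} {ψ : Chronicle O SV T}
    (hψ : ψ.actions.Finite) (hs : s.chronicle.actions ⊆ s'.chronicle.actions)
    {a : Action O SV T} (ha : a ∈ ψ.actions) (h : a ∉ s.chronicle.actions)
    (h' : a ∈ s'.chronicle.actions) : s'.rank ψ < s.rank ψ := by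
  refine Prod.Lex.toLex_lt_toLex.2 (.inl (Set.ncard_lt_ncard ?_ hψ.sdiff))
  exact ⟨Set.sdiff_subset_sdiff_right hs, fun h1 => (h1 ⟨ha, h⟩).2 h'⟩

theorem IsCompletion.wellFormed (h : s.IsCompletion P ψ) : ψ.WellFormed P :=
  (Chronicle.wellFormed_initial P).of_reachable h.1.1

theorem IsCompletion.mem_instances (h : s.IsCompletion P ψ) (hσ : σ ∈ ψ.instances) :
    σ ∈ s.chronicle.instances :=
  h.2.1.extends.instances_subset hσ

/-- The refinement found in a completion resolves an unrefined task. -/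
theorem IsCompletion.leadsTo_refine (h : s.IsCompletion P ψ) (hσ : σ ∈ ψ.instances)
    {τ : PlanTask O T} (hτ : τ ∈ s.chronicle.tasks) :
    ∃ ρ ψ', s.LeadsTo P ψ σ (.unrefined τ) ρ ψ' := by
  have hψ := h.wellFormed
  -- A solution plan has no unrefined task, so `τ` is refined on every path to `ψ`, and this can be
  -- done first.
  obtain ⟨a, ha, hk, hsym, hr⟩ := h.2.1.refine_first hτ (by rw [h.1.2.1]; exact fun h => h.elim)
  have hx := hr.extends
  have haψ : a ∈ ψ.actions := hx.actions (.inr rfl)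
  have hτa : (τ, a) ∈ ψ.refinements := hx.refinements (.inr rfl)
  have hu : ∀ c ∈ a.unifyTask τ, c.Sat σ := fun c hc => hσ.1 c (hx.constraints (.inr hc))
  refine ⟨.refine τ a, ψ, ⟨rfl, ha, hk, hsym, ⟨σ, h.mem_instances hσ, ?_, hu⟩, ?_⟩,
    .refl h.1 hσ, ⟨h.1, hr, h.2.2⟩, ?_⟩
  · exact Action.isInstance_comap hσ (hψ.action_assertions a haψ) (hψ.action_constraints a haψ)
  · intro α _ hα
    obtain ⟨β, hβ, hd⟩ := h.2.2 α ⟨τ, hα⟩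
    obtain ⟨f, h1, h2, -, -⟩ := hβ.2 σ hσ
    obtain ⟨b, hb, hp⟩ := (hd τ hα).possibleEffect hψ hσ h2
    -- The possible effect belongs to the action that refines `τ` in `ψ`, which is the chosen `a`.
    obtain rfl := hψ.action_unique _ _ _ hτa hb
    exact ⟨σ, h.mem_instances hσ, hu, f, _, h1, hp⟩
  · exact rank_lt_of_actions hψ.finite_actions Set.subset_union_left haψ
      (fun h' => hk.1 a h' rfl) (.inr rfl)

/-- A conflict that does not occur in a completion is resolved by a separation constraint. -/
theorem IsCompletion.leadsTo_post (h : s.IsCompletion P ψ) (hσ : σ ∈ ψ.instances)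
    {α β : Assertion Name O SV} {p q : Requirement Name O SV}
    (hx : s.IsFlaw (.conflict α β p q)) :
    ∃ ρ ψ', s.LeadsTo P ψ σ (.conflict α β p q) ρ ψ' := by
  obtain ⟨hα, hβ, hne, hp, hq, σ', hσ', hc⟩ := hx
  have hα' := h.2.1.extends.assertions hα
  have hβ' := h.2.1.extends.assertions hβ
  obtain ⟨c, hc', hs⟩ := Requirement.exists_separation (hσ.2 α hα') (hσ.2 β hβ') hp hq hc
    (h.1.2.2.2.2 σ hσ α hα' β hβ' hne p hp q hq)
  have he := h.1.post hσ hs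
  refine ⟨.post c, ψ.restrict ∅ {c}, hc', he, ⟨he.2.1,
    h.2.1.restrict_both (Chronicle.covers_separation hα hβ hp hq hc'), ?_⟩, ?_⟩
  · intro γ hγ
    obtain ⟨δ, h1, h2⟩ := h.2.2 γ hγ
    exact ⟨δ, h1.restrict _ _, fun τ hτ => (h2 τ hτ).mono (.restrict _ _ _)⟩
  · have hF : (ψ.restrict ∅ {c}).assertions = ψ.assertions := Set.union_empty _
    -- Posting a constraint changes neither actions, assertions, links nor commitments. Only the set
    -- of possible conflicts shrinks, losing at least the selected one.
    refine Prod.Lex.toLex_lt_toLex.2 (.inr ⟨rfl, Prod.Lex.toLex_lt_toLex.2 (.inr ⟨?_,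
      Prod.Lex.toLex_lt_toLex.2 (.inr ⟨?_, Set.ncard_lt_ncard ?_
        (s.finite_threats h.wellFormed.finite_assertions)⟩)⟩)⟩)
    · simp only [openAssertions, hF, transform]
    · simp only [openCommitments, transform, Chronicle.restrict, Set.union_empty]
    · have hi := (Chronicle.Extends.restrict s.chronicle ∅ {c}).instances_subset
      refine ⟨?_, fun hsub => ?_⟩
      · rintro x ⟨h1, h2, τ, hτ, h3⟩
        exact ⟨by simpa only [hF] using h1, h2, τ, hi hτ, h3⟩
      · obtain ⟨-, -, τ, hτ, h3⟩ :=
          hsub (a := ((α, β), p, q)) ⟨⟨hα', hβ'⟩, ⟨hp, hq⟩, σ', hσ', hc⟩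
        exact Requirement.not_conflict_of_separation hc' (hτ.1 c (.inr rfl)) h3

/-- A causal supporter that belongs to the chronicle can be linked. -/
theorem IsCompletion.leadsTo_link (h : s.IsCompletion P ψ) (hσ : σ ∈ ψ.instances)
    {α β : Assertion Name O SV} (hα : s.Unsupported α) (hβ : ψ.Supports β α)
    (hβs : β ∈ s.chronicle.assertions)
    (hd : ∀ τ ∈ s.commitments α, s.chronicle.AddedUnder τ β) :
    ∃ ρ ψ', s.LeadsTo P ψ σ (.unsupported α) ρ ψ' := by
  have he := h.1.link hσ hβ
  obtain ⟨f, h1, h2, -⟩ := hβ.2 σ hσ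
  refine ⟨.link β α, _, ⟨rfl, hβs, ⟨σ, h.mem_instances hσ, f, h1, h2⟩, hd⟩, he,
    ⟨he.2.1, h.2.1.restrict_both (Chronicle.covers_link hβs hα.1), ?_⟩, ?_⟩
  · intro γ hγ
    obtain ⟨δ, h1, h2⟩ := h.2.2 γ hγ
    exact ⟨δ, h1.restrict _ _, fun τ hτ => (h2 τ hτ).mono (.restrict _ _ _)⟩
  · refine Prod.Lex.toLex_lt_toLex.2 (.inr ⟨rfl, Prod.Lex.toLex_lt_toLex.2
      (.inl (Set.ncard_lt_ncard ⟨?_, fun hsub => ?_⟩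
        (h.wellFormed.finite_assertions.subset fun _ h => h.1)))⟩)
    · rintro γ ⟨hγ, h3, h4⟩
      -- The link added to `ψ` does not count as open, as it is a causal link of the new state;
      -- meanwhile `α` is no longer open.
      refine ⟨hγ.resolve_right (h3 (β, α) (.inr rfl)), fun l hl => h3 l (.inl hl),
        fun δ hl => h4 δ (.inl hl)⟩
    · exact (hsub ⟨h.2.1.extends.assertions hα.1, hα.2.2⟩).2.2 β (.inr rfl)

/-- A causal supporter found below an unrefined task allows for a commitment to this task. -/
theorem IsCompletion.leadsTo_supportFromTask (h : s.IsCompletion P ψ) (hs : s.WellFormed P)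
    (hσ : σ ∈ ψ.instances)
    {α β : Assertion Name O SV} (hα : s.Selectable (.unsupported α)) (hβ : ψ.Supports β α)
    (hd : ∀ τ ∈ s.commitments α, ψ.AddedUnder τ β)
    {τ : PlanTask O T} (hτ : τ ∈ s.chronicle.tasks) (hτβ : ψ.AddedUnder τ β)
    (hdesc : ∀ τ' ∈ s.commitments α, s.chronicle.TaskDescends τ' τ) :
    ∃ ρ ψ', s.LeadsTo P ψ σ (.unsupported α) ρ ψ' := by
  have hψ := h.wellFormed
  obtain ⟨f, h1, h2, h3, -⟩ := hβ.2 σ hσ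
  obtain ⟨a, ha, hp⟩ := hτβ.possibleEffect hψ hσ h2
  rcases hψ.unify τ a ha with rfl | ⟨hu, -⟩
  · exact (hs.chronicle.task_origin _ hτ _ rfl).elim
  have hargs : a.task.args.map (ObjTerm.eval σ) = τ.task.args.map (ObjTerm.eval σ) :=
    hσ.1 _ (hu (.inl rfl))
  have hstart : a.task.start.eval σ = τ.task.start.eval σ := hσ.1 _ (hu (.inr (.inl rfl)))
  have hdelay : β.finish.eval σ - a.task.start.eval σ ∈
      taskDelays P τ.task.sym (τ.task.args.map (ObjTerm.eval σ)) f := by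
    refine ⟨a.template, hψ.mem_templates a (hψ.mem_actions _ _ ha), _, hψ.task_sym _ _ ha, ?_, hp⟩
    rw [← hargs]
    exact (ObjTerm.map_eval_map _ _ _).symm
  refine ⟨.supportFromTask α τ, ψ, ⟨rfl, hτ, ⟨σ, h.mem_instances hσ, f, h1, ⟨_, hdelay⟩, ?_⟩,
    hdesc⟩, .refl h.1 hσ, ⟨h.1, h.2.1, ?_⟩, ?_⟩
  -- The infimum is at most the delay observed under `σ`, and `β` ends before `α` starts.
  · refine (iInf₂_le _ hdelay).trans ?_
    rw [hstart]
    exact EReal.coe_le_coe_iff.2 (by exact_mod_cast sub_le_sub_right h3 _)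
  · rintro γ hγ
    by_cases he : γ = α
    · subst he
      refine ⟨β, hβ, ?_⟩
      rintro τ' (hτ' | ⟨-, rfl⟩)
      exacts [hd τ' hτ', hτβ]
    · have hc : ∀ τ', τ' ∈ s.commit α τ γ → τ' ∈ s.commitments γ := fun τ' hτ' =>
        hτ'.resolve_right fun h' => he h'.1
      obtain ⟨δ, h4, h5⟩ := h.2.2 γ (hγ.imp hc)
      exact ⟨δ, h4, fun τ' hτ' => h5 τ' (hc τ' hτ')⟩
  · refine Prod.Lex.toLex_lt_toLex.2 (.inr ⟨rfl, Prod.Lex.toLex_lt_toLex.2 (.inr ⟨rfl,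
      Prod.Lex.toLex_lt_toLex.2 (.inl (Set.ncard_lt_ncard ⟨?_, fun hsub => ?_⟩
        ((hψ.finite_assertions.prod (hψ.finite_refinements.image _)).subset
          fun _ h => ⟨h.1, h.2.1⟩)))⟩)⟩)
    · rintro x ⟨h4, h5, h6⟩
      exact ⟨h4, h5, fun h7 => h6 (.inl h7)⟩
    · refine (hsub (a := (α, τ)) ⟨h.2.1.extends.assertions hα.1.1, ⟨_, ha, rfl⟩, ?_⟩).2.2
        (.inr ⟨rfl, rfl⟩)
      -- The commitment is new: a selectable `α` is not committed to any unrefined task.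
      exact fun h4 => hα.2 α rfl τ h4 hτ

/-- A causal supporter found below an inserted action allows for the insertion of this action. -/
theorem IsCompletion.leadsTo_supportFromAction (h : s.IsCompletion P ψ) (hs : s.WellFormed P)
    (hσ : σ ∈ ψ.instances) {α β : Assertion Name O SV} (hβ : ψ.Supports β α)
    (hc : s.commitments α = ∅) {a : Action O SV T} (ha : (a.rootTask, a) ∈ ψ.refinements)
    (ha' : a ∉ s.chronicle.actions) (haβ : ψ.AddedUnder a.rootTask β) :
    ∃ ρ ψ', s.LeadsTo P ψ σ (.unsupported α) ρ ψ' := by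
  have hψ := h.wellFormed
  obtain ⟨f, h1, h2, h3, -⟩ := hβ.2 σ hσ
  obtain ⟨b, hb, hp⟩ := haβ.possibleEffect hψ hσ h2
  obtain rfl := hψ.action_unique _ _ _ ha hb
  obtain ⟨h4, h5, h6, h7⟩ :=
    h.2.1.insert_first hs.chronicle (fun h' => ha' (hs.chronicle.mem_actions _ _ h')) ha
  refine ⟨.supportFromAction α a, ψ, ⟨rfl, hc, h4, h5, h6, σ, h.mem_instances hσ, f, h1, _, _, hp⟩,
    .refl h.1 hσ, ⟨h.1, h7, ?_⟩, rank_lt_of_actions hψ.finite_actions Set.subset_union_left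
      (hψ.mem_actions _ _ ha) ha' (.inr rfl)⟩
  rintro γ hγ
  by_cases he : γ = α
  · subst he
    refine ⟨β, hβ, ?_⟩
    rintro τ' (hτ' | ⟨-, rfl⟩)
    · rw [hc] at hτ'
      exact hτ'.elim
    · exact haβ
  · have hc : ∀ τ', τ' ∈ s.commit α a.rootTask γ → τ' ∈ s.commitments γ := fun τ' hτ' =>
      hτ'.resolve_right fun h' => he h'.1
    obtain ⟨δ, h4, h5⟩ := h.2.2 γ (hγ.imp hc)
    exact ⟨δ, h4, fun τ' hτ' => h5 τ' (hc τ' hτ')⟩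

/-- An action whose assertion belongs to the chronicle is not new. -/
theorem not_fresh_of_mem {φ : Chronicle O SV T} {β : Assertion Name O SV}
    (hβ : β ∈ φ.assertions) {b : Action O SV T} (hb : β ∈ b.assertions) : ¬ φ.Fresh b.id := fun h =>
  h.2.2.1 β hβ _ β.finish_mem_names (Action.fst_of_mem_assertion_names hb β.finish_mem_names)

/-- Every assertion has temporal variables, and these carry the identifier of the action that owns
them. -/
theorem eq_of_mem_assertions {φ : Chronicle O SV T} (hφ : φ.WellFormed P)
    {β : Assertion Name O SV} {a b : Action O SV T} (ha : a ∈ φ.actions) (hb : b ∈ φ.actions)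
    (haβ : β ∈ a.assertions) (hbβ : β ∈ b.assertions) : a = b :=
  hφ.id_inj a ha b hb (Option.some_injective _
    ((Action.fst_of_mem_assertion_names haβ β.finish_mem_names).symm.trans
      (Action.fst_of_mem_assertion_names hbβ β.finish_mem_names)))

/-- The causal support found in a completion resolves an unsupported assertion. -/
theorem IsCompletion.leadsTo_support (h : s.IsCompletion P ψ) (hs : s.WellFormed P)
    (hσ : σ ∈ ψ.instances) {α : Assertion Name O SV} (hα : s.Selectable (.unsupported α)) :
    ∃ ρ ψ', s.LeadsTo P ψ σ (.unsupported α) ρ ψ' := by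
  have hψ := h.wellFormed
  have hφ := hs.chronicle
  have hx := h.2.1.extends
  have hrefined : ∀ τ ∈ s.commitments α, ∃ c, (τ, c) ∈ s.chronicle.refinements := fun τ hτ =>
    (hs.commitments α τ hτ).resolve_left (hα.2 α rfl τ hτ)
  obtain ⟨β, hβ, hd⟩ : ∃ β, ψ.Supports β α ∧ ∀ τ ∈ s.commitments α, ψ.AddedUnder τ β := by
    rcases (s.commitments α).eq_empty_or_nonempty with he | hne
    · obtain ⟨β, hβ⟩ := (h.1.2.2.1 α (hx.assertions hα.1.1)).resolve_left hα.1.2.1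
      exact ⟨β, hβ, by simp [he]⟩
    · exact h.2.2 α hne
  -- If `β` is present already, a direct link works. The action that added `β` is then not new, so
  -- its descent from each committed task is visible in the current chronicle.
  by_cases hβs : β ∈ s.chronicle.assertions
  · refine h.leadsTo_link hσ hα.1 hβ hβs fun τ hτ => ?_
    obtain ⟨b, hb, hβb, hdb⟩ := hd τ hτ
    rcases hdb.old_or_new hφ hψ hx (hrefined τ hτ) with hdb' | ⟨τ', hτ', -, hdb'⟩
    · exact ⟨b, hdb'.mem_actions hφ, hβb, hdb'⟩
    · exact (not_fresh_of_mem hβs hβb (hdb'.fresh h.2.1 hφ hτ')).elim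
  · obtain ⟨b, hb, hβb⟩ : ∃ b ∈ ψ.actions, β ∈ b.assertions := by
      rcases h.2.1.assertion_cases hβ.1 with h1 | h1 | h1
      · exact (hβs h1).elim
      · obtain ⟨f, -, ⟨w, hw, -⟩, -⟩ := hβ.2 σ hσ
        cases β <;> simp_all [Assertion.IsPersistence, Assertion.produces]
      · exact h1
    have hbs : b ∉ s.chronicle.actions := fun hb' => hβs (hφ.action_assertions b hb' hβb)
    -- For each commitment, `AddedUnder` might name a different action, but only one action owns
    -- `β`.
    have hdb : ∀ τ ∈ s.commitments α, ψ.Descends τ b := by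
      intro τ hτ
      obtain ⟨c, hc, hβc, hdc⟩ := hd τ hτ
      rwa [eq_of_mem_assertions hψ hb hc hβb hβc]
    have hnew : ∀ τ ∈ s.commitments α, ∃ τ' ∈ s.chronicle.tasks,
        s.chronicle.TaskDescends τ τ' ∧ ψ.Descends τ' b := fun τ hτ =>
      ((hdb τ hτ).old_or_new hφ hψ hx (hrefined τ hτ)).resolve_left
        fun h' => hbs (h'.mem_actions hφ)
    -- The actions below an unrefined task are new, so their subtasks are not tasks of the current
    -- chronicle.
    have hnot : ∀ τ ∈ s.chronicle.tasks, ∀ τ' ∈ s.chronicle.tasks, ¬ ψ.TaskDescends τ τ' := by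
      rintro τ hτ τ' hτ' ⟨c, hc, hs⟩
      exact (hc.fresh h.2.1 hφ hτ).not_mem_subtasks hτ' hs
    -- Any unrefined task above `b` can serve. Each commitment yields some unrefined task below it
    -- and above `b`; by comparability and `hnot` this is always the same task.
    have hfrom : ∀ τ ∈ s.chronicle.tasks, ψ.Descends τ b →
        ∃ ρ ψ', s.LeadsTo P ψ σ (.unsupported α) ρ ψ' := by
      intro τ hτ hτb
      refine h.leadsTo_supportFromTask hs hσ hα hβ hd hτ ⟨b, hb, hβb, hτb⟩ fun τ₁ hτ₁ => ?_
      obtain ⟨τ₂, hτ₂, hd₂, hb₂⟩ := hnew τ₁ hτ₁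
      rcases hτb.comparable hψ hb₂ with rfl | h' | h'
      · exact hd₂
      · exact (hnot _ hτ _ hτ₂ h').elim
      · exact (hnot _ hτ₂ _ hτ h').elim
    -- Inserting a new root action is an option only without commitments; otherwise `hnew` already
    -- provides an unrefined task above `b`.
    rcases (s.commitments α).eq_empty_or_nonempty with he | ⟨τ, hτ⟩
    · rcases h.2.1.exists_ancestor.1 b hb with h' | ⟨τ, hτb, hτ | ⟨a, rfl, ha, ha'⟩⟩
      · exact (hbs h').elim
      · exact hfrom τ hτ hτb
      · exact h.leadsTo_supportFromAction hs hσ hβ he ha ha' ⟨b, hb, hβb, hτb⟩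
    · obtain ⟨τ', hτ', -, hb'⟩ := hnew τ hτ
      exact hfrom τ' hτ' hb'

/-- The resolvers cover every completion. -/
theorem IsCompletion.leadsTo (h : s.IsCompletion P ψ) (hs : s.WellFormed P)
    (hσ : σ ∈ ψ.instances) {x : Flaw O SV T} (hx : s.Selectable x) :
    ∃ ρ ψ', s.LeadsTo P ψ σ x ρ ψ' := by
  cases x with
  | unrefined τ => exact h.leadsTo_refine hσ hx.1
  | unsupported α => exact h.leadsTo_support hs hσ hx
  | conflict α β p q => exact h.leadsTo_post hσ hx.1

/-! ## Completeness -/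

theorem isCompletion_initial (h : IsSolution P ψ) : (initial P).IsCompletion P ψ :=
  ⟨h, h.1, fun _ hα => (Set.not_nonempty_empty hα).elim⟩

/-- The procedure can reach every completion. -/
theorem IsCompletion.fape {select : SearchState O SV T → Flaw O SV T}
    (hsel : IsStrategy select) (hs : s.WellFormed P) (h : s.IsCompletion P ψ)
    (hσ : σ ∈ ψ.instances) :
    ∃ φ ψ', Fape P select s φ ∧ IsExplicitation P σ ψ ψ' ∧ Reachable P φ ψ' := by
  -- The target is generalized together with the state: links and constraints enlarge `ψ` on the
  -- way, and the rank is measured against the current target.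
  induction hr : s.rank ψ using WellFoundedLT.induction generalizing s ψ with
  | ind r ih =>
    subst hr
    by_cases hx : ∃ x, s.IsFlaw x
    · obtain ⟨ρ, ψ₁, h1⟩ := h.leadsTo hs hσ (hsel s hx)
      obtain ⟨φ, ψ', h2, h3, h4⟩ := ih _ h1.rank_lt (hs.transform (hsel s hx).1 h1.isResolver)
        h1.isCompletion h1.isExplicitation.2.2 rfl
      exact ⟨φ, ψ', .step s ρ φ hx h1.isResolver h2, h1.isExplicitation.trans h3, h4⟩
    · push Not at hx
      exact ⟨_, ψ, .done s hx ⟨σ, h.mem_instances hσ⟩, .refl h.1 hσ, h.2.1⟩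

end SearchState
end FAPE

/-! ### Soundness, completeness and coverage -/

theorem mainTheorem1 {O SV T : Type*} (P : FAPE.Problem O SV T) :
    -- Soundness: every chronicle that is returned is a solution plan.
    (∀ select, FAPE.IsStrategy select → ∀ φ,
      FAPE.Fape P select (FAPE.SearchState.initial P) φ → FAPE.IsSolution P φ) ∧
    -- Completeness: whatever flaws are selected, a solution plan is found if there is one.
    (∀ select, FAPE.IsStrategy select → (∃ ψ, FAPE.IsSolution P ψ) →
      ∃ φ, FAPE.Fape P select (FAPE.SearchState.initial P) φ) ∧
    -- No solution plan, and no instantiation of it, is overlooked: some returned chronicle leads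
    -- to it by plan transformations.
    (∀ select, FAPE.IsStrategy select → ∀ ψ, FAPE.IsSolution P ψ → ∀ σ ∈ ψ.instances,
      ∃ φ ψ', FAPE.Fape P select (FAPE.SearchState.initial P) φ ∧
        FAPE.IsExplicitation P σ ψ ψ' ∧ FAPE.Reachable P φ ψ') ∧
    -- For each flaw of each type, the set of resolvers covers every solution plan.
    (∀ ψ, FAPE.IsSolution P ψ → (FAPE.SearchState.initial P).IsCompletion P ψ) ∧
    (∀ s, FAPE.InSearchSpace P s → ∀ x, s.Selectable x →
      ∀ ψ, s.IsCompletion P ψ → ∀ σ ∈ ψ.instances,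
        ∃ ρ ψ', s.IsResolver P x ρ ∧ FAPE.IsExplicitation P σ ψ ψ' ∧
          (s.transform ρ).IsCompletion P ψ') := by
  have hinit := (FAPE.InSearchSpace.initial (P := P)).wellFormed
  refine ⟨fun select hsel φ h => h.isSolution hsel hinit, ?_, ?_,
    fun ψ h => FAPE.SearchState.isCompletion_initial h, ?_⟩
  · rintro select hsel ⟨ψ, h⟩
    -- Necessary consistency includes the existence of an instantiation, which guides the search.
    obtain ⟨σ, hσ⟩ := h.2.2.2.1
    obtain ⟨φ, -, hφ, -⟩ := (FAPE.SearchState.isCompletion_initial h).fape hsel hinit hσ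
    exact ⟨φ, hφ⟩
  · exact fun select hsel ψ h σ hσ =>
      (FAPE.SearchState.isCompletion_initial h).fape hsel hinit hσ
  · intro s hs x hx ψ h σ hσ
    obtain ⟨ρ, ψ', h1⟩ := h.leadsTo hs.wellFormed hσ hx
    exact ⟨ρ, ψ', h1.isResolver, h1.isExplicitation, h1.isCompletion⟩
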